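/- Consider $N\ge 1$ linear systems of state dimension $n\ge 1$ and output dimension $p$, given by real matrices $A_i, A_{ij}, G_i\in\mathbb{R}^{n\times n}$ ($j\ne i$) and $c_i\in\mathbb{R}^{n\times p}$, $i=1,\dots,N$. Assume that for each $i$ the pair $(A_i,c_i)$ is observable, $G_i$ is nonsingular, and the triplet $(A_i,c_i,G_iG_i^\top)$ is regular; here $(A,c,P)$ with $(A,c)$ observable and $P>0$ is called regular if for some $r>0$ the pair $(A,\Sigma c)$ is controllable, where $\Sigma$ is the positive definite solution of $A\Sigma+\Sigma A^\top-r\Sigma cc^\top\Sigma+P=0$. Let $r_{\min}>0$ and $\sigma_{\max}>0$. For $\epsilon\in\mathbb{R}$ let $A=A(\epsilon)$ be the $nN\times nN$ matrix with diagonal blocks $A_i$ and off-diagonal blocks $\epsilon A_{ij}$, let $G=\operatorname{diag}(G_1,\dots,G_N)$, and for $\gamma\in\mathbb{R}^N$ with all $\gamma_i>-r_{\min}$ let $c_\gamma=\operatorname{diag}(\sqrt{\gamma_1+r_{\min}}\,c_1,\dots,\sqrt{\gamma_N+r_{\min}}\,c_N)$, and let $\eta(\gamma)=\operatorname{tr}\Sigma(\gamma)$,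 where $\Sigma(\gamma)$ is the positive definite solution of $$A\Sigma+\Sigma A^\top-\Sigma c_\gamma c_\gamma^\top\Sigma+GG^\top=0 .$$ For $\sigma\ge0$ let $\operatorname{Sp}[\sigma]=\{v\in\mathbb{R}^N : v_i\ge 0,\ \sum_i v_i=\sigma\}$, and let $f(\sigma)=\arg\min_{\gamma\in\operatorname{Sp}[\sigma]}\eta(\gamma)$ be the optimal allocation map. Call $\mu\in\mathbb{R}$ a KKT multiplier at $\sigma$ if $\frac{\partial\eta}{\partial\gamma_i}(f(\sigma))=\mu$ whenever $f_i(\sigma)>0$ and $\frac{\partial\eta}{\partial\gamma_j}(f(\sigma))\ge\mu$ whenever $f_j(\sigma)=0$. Let $\mu_\sigma$ be the KKT multiplier at $\sigma$ (for $\sigma>0$ it is unique; for $\sigma=0$ take the largest one), and let $\mathcal J_\sigma=\{i : \frac{\partial\eta}{\partial\gamma_i}(f(\sigma))=\mu_\sigma\}$. Then there is $\epsilon_0>0$ (depending on the above data, including $r_{\min}$ and $\sigma_{\max}$) such that for every $\epsilon$ with $|\epsilon|\le\epsilon_0$ the following hold. 1. These objects are well defined: for every $\gamma\in\bigcup_{0\le\sigma\le\sigma_{\max}}\operatorname{Sp}[\sigma]$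 the Riccati equation has exactly one positive definite solution and $\eta$ is differentiable at $\gamma$; and for every $\sigma\in[0,\sigma_{\max}]$ the function $\eta$ has exactly one minimizer $f(\sigma)$ on $\operatorname{Sp}[\sigma]$, and $\mu_\sigma$ exists. 2. For every $\sigma\in[0,\sigma_{\max})$ the right-derivative $\partial_+f(\sigma)=\lim_{h\to0,\,h>0}\frac{f(\sigma+h)-f(\sigma)}{h}$ exists, the map $\partial_+f$ is right-continuous at $\sigma$, and $$\partial_+f_i(\sigma)>0\ \text{ if } i\in\mathcal J_\sigma,\qquad \partial_+f_i(\sigma)=0\ \text{ if } i\notin\mathcal J_\sigma .$$ -/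

import Mathlib

open Set Filter Topology

namespace OptAlloc

noncomputable section

/-! ### Linear systems: controllability, observability, algebraic Riccati equations -/

/-- The controllability matrix `[B, A B, …, A ^ (d - 1) B]` of a pair `(A, B)`, where `d` is
the state dimension. Its columns are indexed by pairs (power of `A`, column of `B`). -/
def controllabilityMatrix {m q : Type*} [Fintype m] [DecidableEq m]
    (A : Matrix m m ℝ) (B : Matrix m q ℝ) : Matrix m (Fin (Fintype.card m) × q) ℝ :=
  Matrix.of fun i kj => (A ^ (kj.1 : ℕ) * B) i kj.2

/-- The pair `(A, B)` (dynamics `ẋ = A x + B u`) is controllable: Kalman's rank condition. -/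
def Controllable {m q : Type*} [Fintype m] [DecidableEq m] [Fintype q]
    (A : Matrix m m ℝ) (B : Matrix m q ℝ) : Prop :=
  (controllabilityMatrix A B).rank = Fintype.card m

/-- The pair `(A, c)` (dynamics `ẋ = A x`, output `y = cᵀ x`) is observable: the observability
matrix, i.e. the transpose of `[c, Aᵀ c, …, (Aᵀ) ^ (d - 1) c]`, has full rank. -/
def Observable {m q : Type*} [Fintype m] [DecidableEq m] [Fintype q]
    (A : Matrix m m ℝ) (c : Matrix m q ℝ) : Prop :=
  Controllable A.transpose c

/-- `X` is a positive definite solution of the algebraic Riccati equation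
`A X + X Aᵀ - X c cᵀ X + P = 0`. -/
def IsPosDefAREsol {m q : Type*} [Fintype m] [Fintype q]
    (A : Matrix m m ℝ) (c : Matrix m q ℝ) (P X : Matrix m m ℝ) : Prop :=
  X.PosDef ∧ A * X + X * A.transpose - X * (c * c.transpose) * X + P = 0

/-- `(A, c, P)` is a regular triplet: `(A, c)` is observable, `P` is positive definite, and for
some `r > 0` the pair `(A, X c)` is controllable, where `X` is the positive definite solution of
`A X + X Aᵀ - r X c cᵀ X + P = 0`. -/
def RegularTriplet {m q : Type*} [Fintype m] [DecidableEq m] [Fintype q]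
    (A : Matrix m m ℝ) (c : Matrix m q ℝ) (P : Matrix m m ℝ) : Prop :=
  Observable A c ∧ P.PosDef ∧
    ∃ r : ℝ, 0 < r ∧ ∃ X : Matrix m m ℝ,
      IsPosDefAREsol A (Real.sqrt r • c) P X ∧ Controllable A (X * c)

/-! ### Simplices and right-derivatives -/

/-- The simplex `Sp[σ]` of height `σ` in `ℝ^N`. -/
def Sp (N : ℕ) (σ : ℝ) : Set (Fin N → ℝ) :=
  {v | (∀ i, 0 ≤ v i) ∧ ∑ i, v i = σ}

/-- `Ch[σ_max]`, the union of the simplices `Sp[σ]` for `0 ≤ σ ≤ σ_max`. -/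
def Ch (N : ℕ) (σmax : ℝ) : Set (Fin N → ℝ) :=
  ⋃ σ ∈ Set.Icc 0 σmax, Sp N σ

/-- The right-derivative `∂₊ f (σ)` (meaningful where the one-sided limit exists). -/
def rightDeriv {N : ℕ} (f : ℝ → Fin N → ℝ) (σ : ℝ) : Fin N → ℝ :=
  derivWithin f (Set.Ioi σ) σ

/-! ### Networks of weakly coupled systems -/

/-- The data of a network of `N` linear systems with state dimension `n` and output dimension `p`:
`dx_i = (A_i x_i + ε ∑_{j ≠ i} A_{ij} x_j) dt + G_i dw_i`, `dz_i = √r_i c_iᵀ x_i dt + dν_i`. -/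
structure Network (N n p : ℕ) where
  /-- internal dynamics `A_i` -/
  A : Fin N → Matrix (Fin n) (Fin n) ℝ
  /-- coupling matrices `A_{ij}`; only the values at `i ≠ j` are used -/
  Acoup : Fin N → Fin N → Matrix (Fin n) (Fin n) ℝ
  /-- noise matrices `G_i` -/
  G : Fin N → Matrix (Fin n) (Fin n) ℝ
  /-- observation matrices `c_i` -/
  c : Fin N → Matrix (Fin n) (Fin p) ℝ

namespace Network

variable {N n p : ℕ} (S : Network N n p)

/-- The standing assumption on the subsystems. -/
def SubsystemAssumption : Prop :=
  ∀ i, Observable (S.A i) (S.c i) ∧ IsUnit (S.G i) ∧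
    RegularTriplet (S.A i) (S.c i) (S.G i * (S.G i).transpose)

/-- The `nN × nN` matrix with diagonal blocks `A_i` and off-diagonal blocks `ε A_{ij}`.
An index `(k, i)` stands for the `k`-th coordinate of the `i`-th subsystem. -/
def bigA (ε : ℝ) : Matrix (Fin n × Fin N) (Fin n × Fin N) ℝ :=
  Matrix.of fun a b =>
    if a.2 = b.2 then S.A a.2 a.1 b.1 else ε * S.Acoup a.2 b.2 a.1 b.1

/-- `G = diag(G_1, …, G_N)`. -/
def bigG : Matrix (Fin n × Fin N) (Fin n × Fin N) ℝ :=
  Matrix.blockDiagonal S.G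

/-- `c_γ = diag(√(γ_1 + r_min) c_1, …, √(γ_N + r_min) c_N)`. -/
def cγ (rmin : ℝ) (γ : Fin N → ℝ) : Matrix (Fin n × Fin N) (Fin p × Fin N) ℝ :=
  Matrix.blockDiagonal fun i => Real.sqrt (γ i + rmin) • S.c i

/-- `X` is a positive definite solution of the network Riccati equation
`A X + X Aᵀ - X c_γ c_γᵀ X + G Gᵀ = 0`. -/
def IsCov (rmin ε : ℝ) (γ : Fin N → ℝ) (X : Matrix (Fin n × Fin N) (Fin n × Fin N) ℝ) : Prop :=
  IsPosDefAREsol (S.bigA ε) (S.cγ rmin γ) (S.bigG * S.bigG.transpose) X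

/-- `Σ(γ)`, the positive definite solution of the network Riccati equation. -/
def cov (rmin ε : ℝ) (γ : Fin N → ℝ) : Matrix (Fin n × Fin N) (Fin n × Fin N) ℝ :=
  Classical.epsilon (S.IsCov rmin ε γ)

/-- The estimation error `η(γ) = tr Σ(γ)`. -/
def η (rmin ε : ℝ) (γ : Fin N → ℝ) : ℝ :=
  (S.cov rmin ε γ).trace

/-- The partial derivative `∂η / ∂γ_i` at `γ`. -/
def dη (rmin ε : ℝ) (γ : Fin N → ℝ) (i : Fin N) : ℝ :=
  lineDeriv ℝ (S.η rmin ε) γ (Pi.single i 1)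

/-- The optimal allocation map `f(σ) = argmin_{γ ∈ Sp[σ]} η(γ)`. -/
def f (rmin ε : ℝ) (σ : ℝ) : Fin N → ℝ :=
  Classical.epsilon fun γ => γ ∈ Sp N σ ∧ IsMinOn (S.η rmin ε) (Sp N σ) γ

/-- `I_σ`, the set of indices of the positive entries of `f(σ)`. -/
def I (rmin ε : ℝ) (σ : ℝ) : Set (Fin N) :=
  {i | 0 < S.f rmin ε σ i}

/-- `μ` is a KKT multiplier at `f(σ)`: the partial derivatives of `η` at `f(σ)` are equal to `μ`
for the indices in `I_σ`, and at least `μ` for the others. -/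
def IsKKTMultiplier (rmin ε : ℝ) (σ μ : ℝ) : Prop :=
  (∀ i ∈ S.I rmin ε σ, S.dη rmin ε (S.f rmin ε σ) i = μ) ∧
    ∀ j ∉ S.I rmin ε σ, μ ≤ S.dη rmin ε (S.f rmin ε σ) j

/-- The KKT multiplier `μ_σ`. For `σ > 0` the conditions have at most one solution, because `I_σ`
is nonempty; for `σ = 0`, where `f(σ) = 0`, `μ_σ` is the largest solution. -/
def kktMultiplier (rmin ε : ℝ) (σ : ℝ) : ℝ :=
  sSup {μ | S.IsKKTMultiplier rmin ε σ μ}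

/-- `J_σ`, the set of indices `i` with `∂η / ∂γ_i = μ_σ` at `f(σ)`. -/
def J (rmin ε : ℝ) (σ : ℝ) : Set (Fin N) :=
  {i | S.dη rmin ε (S.f rmin ε σ) i = S.kktMultiplier rmin ε σ}

end Network

end

end OptAlloc

/-!
At `ε = 0` the Riccati equation splits into blocks and `η γ = ∑ i, tr X_i (γ_i + r_min)`, where
`X_i r` solves the `i`-th Riccati equation with gain `r`. Differentiating that equation twice shows
that `X_i'' - 2 X_i' X_i⁻¹ X_i'` solves a Lyapunov equation for the stable closed loop with negative
semidefinite right-hand side, so it is positive semidefinite; and `X_i' ≠ 0` because `c_i ≠ 0`.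
Hence `tr X_i'' > 0`, and the Hessian of `η` is diagonal and positive.

The linearized Riccati operator is the Lyapunov operator of the closed loop, which is invertible, so
by the implicit function theorem `η` is `C²` jointly in `(ε, γ)`. Its Hessian `H` therefore stays
diagonally dominant, uniformly over the compact set `Ch[σ_max]`, for all small `ε`; in particular
`η` is strictly convex on the simplices.

Let `J = J_σ`. The implicit function theorem also gives a curve `x` through `f(σ)` along which the
partial derivatives of `η` with indices in `J` agree, the coordinates outside `J` vanish, and the
coordinates sum to the parameter. Its velocity solves `H_JJ v = ν 1`, `∑ v = 1`, and
diagonal dominance forces every entry of `v` to be positive. Thus the curve is feasible to the right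
of `σ`, satisfies the KKT conditions there, and by convexity coincides with `f`.
-/

open scoped Matrix

namespace OptAlloc

noncomputable section

/-! ### Lyapunov operators -/

section Lyapunov

theorem isSymm_of_posSemidef {m : Type*} {X : Matrix m m ℝ} (hX : X.PosSemidef) : X.IsSymm :=
  Matrix.isHermitian_iff_isSymm.1 hX.isHermitian

theorem isSymm_of_posDef {m : Type*} {X : Matrix m m ℝ} (hX : X.PosDef) : X.IsSymm :=
  Matrix.isHermitian_iff_isSymm.1 hX.isHermitian

variable {m : Type*} [Fintype m]

/-- The Lyapunov operator of a matrix `F`; its invertibility and order properties govern the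
linearization of a Riccati equation. -/
def lyapunov (F X : Matrix m m ℝ) : Matrix m m ℝ :=
  F * X + X * Fᵀ

/-- Exponential stability of `ẋ = F x`, encoded by a quadratic Lyapunov certificate `X`. -/
def IsLyapunovStable (F : Matrix m m ℝ) : Prop :=
  ∃ X : Matrix m m ℝ, X.PosDef ∧ (-lyapunov F X).PosDef

theorem posSemidef_mul_mul_transpose {X : Matrix m m ℝ} (hX : X.PosSemidef)
    (B : Matrix m m ℝ) : (B * X * Bᵀ).PosSemidef := by
  simpa using hX.mul_mul_conjTranspose_same B

theorem posSemidef_mul_mul_of_isSymm {X B : Matrix m m ℝ} (hX : X.PosSemidef) (hB : B.IsSymm) :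
    (B * X * B).PosSemidef := by
  simpa only [hB.eq] using posSemidef_mul_mul_transpose hX B

section Conjugation

variable [DecidableEq m]

theorem posSemidef_mul_mul_transpose_iff {L E : Matrix m m ℝ} (hL : IsUnit L) :
    (L * E * Lᵀ).PosSemidef ↔ E.PosSemidef := by
  simpa [Matrix.star_eq_conjTranspose] using Matrix.IsUnit.posSemidef_star_right_conjugate_iff hL

theorem posDef_mul_mul_transpose_iff {L E : Matrix m m ℝ} (hL : IsUnit L) :
    (L * E * Lᵀ).PosDef ↔ E.PosDef := by
  simpa [Matrix.star_eq_conjTranspose] using Matrix.IsUnit.posDef_star_right_conjugate_iff hL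

theorem exists_isUnit_eq_mul_transpose {X : Matrix m m ℝ} (hX : X.PosDef) :
    ∃ L : Matrix m m ℝ, IsUnit L ∧ X = L * Lᵀ := by
  open scoped MatrixOrder Matrix.Norms.L2Operator in
  obtain ⟨L, hL⟩ := CStarAlgebra.nonneg_iff_eq_mul_star_self.1 hX.posSemidef.nonneg
  rw [Matrix.star_eq_conjTranspose, Matrix.conjTranspose_eq_transpose_of_trivial] at hL
  refine ⟨L, ?_, hL⟩
  have hdet := hX.isUnit
  rw [Matrix.isUnit_iff_isUnit_det, hL, Matrix.det_mul] at hdet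
  exact (Matrix.isUnit_iff_isUnit_det _).2 (isUnit_of_mul_isUnit_left hdet)

theorem lyapunov_conj {L : Matrix m m ℝ} (hL : IsUnit L) (G E : Matrix m m ℝ) :
    lyapunov (L * G * L⁻¹) (L * E * Lᵀ) = L * lyapunov G E * Lᵀ := by
  have hdet := (Matrix.isUnit_iff_isUnit_det L).1 hL
  have hleft (M : Matrix m m ℝ) : L⁻¹ * (L * M) = M := Matrix.nonsing_inv_mul_cancel_left L M hdet
  have hright (M : Matrix m m ℝ) : Lᵀ * ((L⁻¹)ᵀ * M) = M := by
    rw [← mul_assoc, ← Matrix.transpose_mul, Matrix.nonsing_inv_mul L hdet, Matrix.transpose_one,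
      one_mul]
  simp only [lyapunov, Matrix.transpose_mul, mul_assoc, mul_add, add_mul, hleft, hright]

theorem exists_mul_mul_transpose_eq {L : Matrix m m ℝ} (hL : IsUnit L) (D : Matrix m m ℝ) :
    ∃ E, D = L * E * Lᵀ := by
  have hdet := (Matrix.isUnit_iff_isUnit_det L).1 hL
  have hdet' : IsUnit Lᵀ.det := by rwa [Matrix.det_transpose]
  refine ⟨L⁻¹ * D * (Lᵀ)⁻¹, ?_⟩
  rw [mul_assoc, mul_assoc, Matrix.nonsing_inv_mul _ hdet', mul_one,
    Matrix.mul_nonsing_inv_cancel_left _ _ hdet]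

theorem IsLyapunovStable.exists_eq_conj {F : Matrix m m ℝ} (hF : IsLyapunovStable F) :
    ∃ L G : Matrix m m ℝ, IsUnit L ∧ F = L * G * L⁻¹ ∧ (-(G + Gᵀ)).PosDef := by
  obtain ⟨X, hX, hFX⟩ := hF
  obtain ⟨L, hL, rfl⟩ := exists_isUnit_eq_mul_transpose hX
  have hdet := (Matrix.isUnit_iff_isUnit_det L).1 hL
  have hFL : F = L * (L⁻¹ * F * L) * L⁻¹ := by
    rw [mul_assoc L⁻¹, Matrix.mul_nonsing_inv_cancel_left _ _ hdet,
      Matrix.mul_nonsing_inv_cancel_right _ _ hdet]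
  refine ⟨L, L⁻¹ * F * L, hL, hFL, ?_⟩
  have hconj : -lyapunov F (L * Lᵀ) = L * -(L⁻¹ * F * L + (L⁻¹ * F * L)ᵀ) * Lᵀ := by
    have hone : lyapunov (L⁻¹ * F * L) 1 = L⁻¹ * F * L + (L⁻¹ * F * L)ᵀ := by
      rw [lyapunov, mul_one, one_mul]
    have h := lyapunov_conj hL (L⁻¹ * F * L) 1
    rw [← hFL, mul_one, hone] at h
    rw [h, Matrix.mul_neg, Matrix.neg_mul]
  rwa [hconj, posDef_mul_mul_transpose_iff hL] at hFX

end Conjugation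

theorem posSemidef_of_dissipative {G E : Matrix m m ℝ} (hG : (-(G + Gᵀ)).PosDef)
    (hE : E.IsSymm) (hGE : (-lyapunov G E).PosSemidef) : E.PosSemidef := by
  classical
  have hEh : E.IsHermitian := Matrix.isHermitian_iff_isSymm.2 hE
  rw [hEh.posSemidef_iff_eigenvalues_nonneg]
  intro i
  set u : m → ℝ := (hEh.eigenvectorBasis i).ofLp
  have hu : u ≠ 0 := fun h =>
    hEh.eigenvectorBasis.orthonormal.ne_zero i (by ext j; exact congrFun h j)
  have hEu : E *ᵥ u = hEh.eigenvalues i • u := hEh.mulVec_eigenvectorBasis i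
  have huE : u ᵥ* E = hEh.eigenvalues i • u := by rw [← Matrix.mulVec_transpose, hE.eq, hEu]
  have hform : u ⬝ᵥ lyapunov G E *ᵥ u = hEh.eigenvalues i * (u ⬝ᵥ (G + Gᵀ) *ᵥ u) := by
    simp only [lyapunov, Matrix.add_mulVec, dotProduct_add, ← Matrix.mulVec_mulVec, hEu,
      Matrix.mulVec_smul, dotProduct_smul, Matrix.dotProduct_mulVec u E, huE, smul_dotProduct,
      smul_eq_mul, mul_add]
  have hpos := hG.dotProduct_mulVec_pos hu
  have hnonneg := hGE.dotProduct_mulVec_nonneg u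
  simp only [star_trivial, Matrix.neg_mulVec, dotProduct_neg, hform] at hpos hnonneg
  exact nonneg_of_mul_nonneg_left (by linarith) hpos

theorem eq_zero_of_mul_mul_transpose_eq_zero {Q B : Matrix m m ℝ} (hQ : Q.PosDef)
    (h : B * Q * Bᵀ = 0) : B = 0 := by
  classical
  obtain ⟨L, hL, rfl⟩ := exists_isUnit_eq_mul_transpose hQ
  rw [← hL.mul_left_eq_zero, ← Matrix.self_mul_conjTranspose_eq_zero,
    Matrix.conjTranspose_eq_transpose_of_trivial, ← h, Matrix.transpose_mul]
  simp only [mul_assoc]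

theorem eq_zero_of_dissipative {G E : Matrix m m ℝ} (hG : (-(G + Gᵀ)).PosDef)
    (hGE : lyapunov G E = 0) : E = 0 := by
  have hrow := (posSemidef_mul_mul_transpose hG.posSemidef E).trace_nonneg
  have hcol := (posSemidef_mul_mul_transpose hG.posSemidef Eᵀ).trace_nonneg
  have hEG : (E * Gᵀ * Eᵀ).trace = (E * G * Eᵀ).trace := by
    rw [← Matrix.trace_transpose]; simp [mul_assoc]
  have hGEt : (Eᵀ * Gᵀ * E).trace = (Eᵀ * G * E).trace := by
    rw [← Matrix.trace_transpose]; simp [mul_assoc]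
  have hpair : (Eᵀ * G * E).trace + (E * Gᵀ * Eᵀ).trace = 0 := by
    rw [Matrix.trace_mul_comm (E * Gᵀ), mul_assoc Eᵀ, ← Matrix.trace_add, ← mul_add, ← lyapunov,
      hGE, mul_zero, Matrix.trace_zero]
  have hzero : (E * -(G + Gᵀ) * Eᵀ).trace = 0 := by
    refine le_antisymm ?_ hrow
    simp only [Matrix.transpose_transpose, Matrix.mul_neg, Matrix.neg_mul, mul_add, add_mul,
      Matrix.trace_neg, Matrix.trace_add] at hrow hcol ⊢
    linarith
  exact eq_zero_of_mul_mul_transpose_eq_zero hG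
    ((posSemidef_mul_mul_transpose hG.posSemidef E).trace_eq_zero_iff.1 hzero)

theorem IsLyapunovStable.posSemidef_of_lyapunov {F D : Matrix m m ℝ} (hF : IsLyapunovStable F)
    (hD : D.IsSymm) (hFD : (-lyapunov F D).PosSemidef) : D.PosSemidef := by
  classical
  obtain ⟨L, G, hL, rfl, hG⟩ := hF.exists_eq_conj
  obtain ⟨E, rfl⟩ := exists_mul_mul_transpose_eq hL D
  have hE : E.IsSymm := by
    have h : L * Eᵀ * Lᵀ = L * E * Lᵀ := by
      rw [← hD.eq]; simp only [Matrix.transpose_mul, Matrix.transpose_transpose, mul_assoc]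
    have hLt : IsUnit Lᵀ := (Matrix.isUnit_transpose L).2 hL
    exact hL.mul_left_cancel (hLt.mul_right_cancel h)
  rw [lyapunov_conj hL, ← Matrix.neg_mul, ← Matrix.mul_neg,
    posSemidef_mul_mul_transpose_iff hL] at hFD
  exact (posSemidef_mul_mul_transpose_iff hL).2 (posSemidef_of_dissipative hG hE hFD)

theorem IsLyapunovStable.eq_zero_of_lyapunov_eq_zero {F D : Matrix m m ℝ}
    (hF : IsLyapunovStable F) (hFD : lyapunov F D = 0) : D = 0 := by
  classical
  obtain ⟨L, G, hL, rfl, hG⟩ := hF.exists_eq_conj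
  obtain ⟨E, rfl⟩ := exists_mul_mul_transpose_eq hL D
  have hLt : IsUnit Lᵀ := (Matrix.isUnit_transpose L).2 hL
  rw [lyapunov_conj hL, hLt.mul_left_eq_zero, hL.mul_right_eq_zero] at hFD
  rw [eq_zero_of_dissipative hG hFD, mul_zero, zero_mul]

end Lyapunov

/-! ### Riccati equations -/

section Riccati

variable {m : Type*} [Fintype m]

/-- The Riccati operator, with `C = c cᵀ` for an output matrix `c`; its zeros are the stationary
error covariances. -/
def riccati (A C P X : Matrix m m ℝ) : Matrix m m ℝ :=
  A * X + X * Aᵀ - X * C * X + P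

/-- The dynamics of the filter error: `X ↦ lyapunov (closedLoop A C X)` linearizes `riccati` at
a symmetric `X`. -/
def closedLoop (A C X : Matrix m m ℝ) : Matrix m m ℝ :=
  A - X * C

theorem transpose_riccati {C P : Matrix m m ℝ} (hC : C.IsSymm) (hP : P.IsSymm)
    (A X : Matrix m m ℝ) : (riccati A C P X)ᵀ = riccati A C P Xᵀ := by
  simp only [riccati, Matrix.transpose_add, Matrix.transpose_sub, Matrix.transpose_mul,
    Matrix.transpose_transpose, hC.eq, hP.eq]
  noncomm_ring

theorem lyapunov_closedLoop {C X : Matrix m m ℝ} (hC : C.IsSymm) (hX : X.IsSymm)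
    (A D : Matrix m m ℝ) :
    lyapunov (closedLoop A C X) D = A * D + D * Aᵀ - X * C * D - D * C * X := by
  rw [lyapunov, closedLoop, Matrix.transpose_sub, Matrix.transpose_mul, hC.eq, hX.eq]
  noncomm_ring

theorem lyapunov_closedLoop_self {C X : Matrix m m ℝ} (hC : C.IsSymm) (hX : X.IsSymm)
    (A P : Matrix m m ℝ) :
    lyapunov (closedLoop A C X) X = riccati A C P X - (P + X * C * X) := by
  rw [lyapunov_closedLoop hC hX, riccati]
  abel

theorem riccati_sub_riccati {C X : Matrix m m ℝ} (hC : C.IsSymm) (hX : X.IsSymm)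
    (A P Y : Matrix m m ℝ) :
    riccati A C P X - riccati A C P Y =
      lyapunov (closedLoop A C X) (X - Y) + (X - Y) * C * (X - Y) := by
  rw [lyapunov_closedLoop hC hX, riccati, riccati]
  noncomm_ring

theorem isLyapunovStable_closedLoop {A C P X : Matrix m m ℝ} (hC : C.PosSemidef)
    (hP : P.PosDef) (hX : X.PosDef) (h : riccati A C P X = 0) :
    IsLyapunovStable (closedLoop A C X) := by
  have hXs := isSymm_of_posDef hX
  refine ⟨X, hX, ?_⟩
  rw [lyapunov_closedLoop_self (isSymm_of_posSemidef hC) hXs A P, h, zero_sub, neg_neg]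
  exact hP.add_posSemidef (posSemidef_mul_mul_of_isSymm hC hXs)

theorem posDef_of_posSemidef_of_riccati_eq_zero {A C P X : Matrix m m ℝ} (hP : P.PosDef)
    (hX : X.PosSemidef) (h : riccati A C P X = 0) : X.PosDef := by
  refine .of_dotProduct_mulVec_pos hX.isHermitian fun x hx =>
    (hX.dotProduct_mulVec_nonneg x).lt_of_ne' fun hx0 => (hP.dotProduct_mulVec_pos hx).ne' ?_
  have hXx : X *ᵥ x = 0 := (hX.dotProduct_mulVec_zero_iff x).1 hx0
  have hxX : x ᵥ* X = 0 := by rw [← Matrix.mulVec_transpose, (isSymm_of_posSemidef hX).eq, hXx]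
  have hform : x ⬝ᵥ riccati A C P X *ᵥ x = x ⬝ᵥ P *ᵥ x := by
    simp only [riccati, Matrix.add_mulVec, Matrix.sub_mulVec, ← Matrix.mulVec_mulVec, hXx,
      Matrix.mulVec_zero, dotProduct_add, Matrix.dotProduct_mulVec x X, hxX, zero_dotProduct,
      sub_zero, zero_add]
  rw [star_trivial, ← hform, h, Matrix.zero_mulVec, dotProduct_zero]

theorem posSemidef_sub_of_riccati_posSemidef {A C P X Y : Matrix m m ℝ} (hC : C.PosSemidef)
    (hP : P.PosDef) (hX : X.PosDef) (hX0 : riccati A C P X = 0) (hY : Y.IsSymm)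
    (hY0 : (riccati A C P Y).PosSemidef) : (X - Y).PosSemidef := by
  have hXY : (X - Y).IsSymm := (isSymm_of_posDef hX).sub hY
  refine (isLyapunovStable_closedLoop hC hP hX hX0).posSemidef_of_lyapunov hXY ?_
  have hdiff := riccati_sub_riccati (isSymm_of_posSemidef hC) (isSymm_of_posDef hX) A P Y
  have hlyap : -lyapunov (closedLoop A C X) (X - Y) =
      riccati A C P Y + (X - Y) * C * (X - Y) := by
    rw [hX0, zero_sub, neg_eq_iff_eq_neg] at hdiff
    rw [hdiff, neg_add, neg_add_cancel_right]
  rw [hlyap]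
  exact hY0.add (posSemidef_mul_mul_of_isSymm hC hXY)

theorem riccati_solution_unique {A C P X Y : Matrix m m ℝ} (hC : C.PosSemidef) (hP : P.PosDef)
    (hX : X.PosDef) (hX0 : riccati A C P X = 0) (hY : Y.PosDef) (hY0 : riccati A C P Y = 0) :
    X = Y := by
  have hXY := posSemidef_sub_of_riccati_posSemidef hC hP hX hX0 (isSymm_of_posDef hY)
    (hY0 ▸ .zero)
  have hYX := posSemidef_sub_of_riccati_posSemidef hC hP hY hY0 (isSymm_of_posDef hX)
    (hX0 ▸ .zero)
  open scoped MatrixOrder in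
  exact le_antisymm (Matrix.le_iff.2 hYX) (Matrix.le_iff.2 hXY)

end Riccati

/-! ### Smooth dependence of Riccati solutions on parameters -/

theorem exists_implicit_function {E₁ E₂ : Type*} [NormedAddCommGroup E₁] [NormedSpace ℝ E₁]
    [CompleteSpace E₁] [NormedAddCommGroup E₂] [NormedSpace ℝ E₂] [FiniteDimensional ℝ E₂]
    {n : WithTop ℕ∞} (hn : n ≠ 0) {f : E₁ × E₂ → E₂} {u : E₁ × E₂} (hf : ContDiffAt ℝ n f u)
    (hinj : ∀ y, fderiv ℝ f u (0, y) = 0 → y = 0) :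
    ∃ ψ : E₁ → E₂, ψ u.1 = u.2 ∧ ContDiffAt ℝ n ψ u.1 ∧
      ∀ᶠ v in 𝓝 u, (f v = f u ↔ ψ v.1 = v.2) := by
  have := FiniteDimensional.complete ℝ E₂
  have hinv : (fderiv ℝ f u ∘L .inr ℝ E₁ E₂).IsInvertible := by
    set g : E₂ →L[ℝ] E₂ := fderiv ℝ f u ∘L .inr ℝ E₁ E₂
    have hg : Function.Injective (g : E₂ →ₗ[ℝ] E₂) := by
      rw [← LinearMap.ker_eq_bot, LinearMap.ker_eq_bot']
      exact hinj
    exact ⟨(LinearEquiv.ofInjectiveEndo (g : E₂ →ₗ[ℝ] E₂) hg).toContinuousLinearEquiv,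
      by ext y; rfl⟩
  exact ⟨hf.implicitFunction hn hinv, hf.implicitFunction_apply_self hn hinv,
    hf.contDiffAt_implicitFunction hn hinv, hf.eventually_apply_eq_iff_implicitFunction hn hinv⟩

theorem hasDerivAt_smul_const {F : Type*} [NormedAddCommGroup F] [NormedSpace ℝ F] (v : F)
    (r : ℝ) : HasDerivAt (fun s : ℝ => s • v) v r := by
  simpa using (hasDerivAt_id r).smul_const v

section Smooth

open scoped Matrix.Norms.Operator

theorem eventually_posDef {m : Type*} [Finite m] {X₀ : Matrix m m ℝ} (h : X₀.PosDef) :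
    ∀ᶠ X in 𝓝 X₀, X.IsSymm → X.PosDef := by
  have := Fintype.ofFinite m
  have hcont : Continuous fun z : Matrix m m ℝ × (m → ℝ) => z.2 ⬝ᵥ z.1 *ᵥ z.2 :=
    continuous_snd.dotProduct (continuous_fst.matrix_mulVec continuous_snd)
  have hsphere : ∀ᶠ X in 𝓝 X₀, ∀ x ∈ Metric.sphere (0 : m → ℝ) 1, 0 < x ⬝ᵥ X *ᵥ x := by
    refine (isCompact_sphere _ _).eventually_forall_of_forall_eventually fun x hx => ?_
    have hx0 : x ≠ 0 := by rintro rfl; simp at hx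
    exact hcont.continuousAt.eventually (lt_mem_nhds (by simpa using h.dotProduct_mulVec_pos hx0))
  filter_upwards [hsphere] with X hX hXs
  refine .of_dotProduct_mulVec_pos (Matrix.isHermitian_iff_isSymm.2 hXs) fun x hx => ?_
  have hunit := hX (‖x‖⁻¹ • x) (by simp [norm_smul, hx])
  rw [Matrix.mulVec_smul, dotProduct_smul, smul_dotProduct, smul_eq_mul, smul_eq_mul] at hunit
  have hinv : 0 ≤ ‖x‖⁻¹ := inv_nonneg.2 (norm_nonneg x)
  exact pos_of_mul_pos_right (pos_of_mul_pos_right hunit hinv) hinv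

theorem hasDerivAt_transpose {m : Type*} [Finite m] {X : ℝ → Matrix m m ℝ} {X' : Matrix m m ℝ}
    {r : ℝ} (h : HasDerivAt X X' r) : HasDerivAt (fun s => (X s)ᵀ) X'ᵀ r := by
  have := Fintype.ofFinite m
  exact (LinearMap.toContinuousLinearMap
    (Matrix.transposeLinearEquiv m m ℝ ℝ).toLinearMap).hasFDerivAt.comp_hasDerivAt r h

theorem isSymm_of_hasDerivAt {m : Type*} [Finite m] {X : ℝ → Matrix m m ℝ} {X' : Matrix m m ℝ}
    {r : ℝ} (hX : HasDerivAt X X' r) (hs : ∀ᶠ s in 𝓝 r, (X s).IsSymm) : X'.IsSymm := by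
  have := Fintype.ofFinite m
  have htranspose := hasDerivAt_transpose hX
  exact HasDerivAt.unique (HasDerivAt.congr_of_eventuallyEq (F := Matrix m m ℝ) htranspose
    (hs.mono fun _ h => h.eq.symm)) hX

variable {m : Type*} [Fintype m]

theorem hasDerivAt_trace {X : ℝ → Matrix m m ℝ} {X' : Matrix m m ℝ} {r : ℝ}
    (h : HasDerivAt X X' r) : HasDerivAt (fun s => (X s).trace) X'.trace r :=
  (LinearMap.toContinuousLinearMap (Matrix.traceLinearMap m ℝ ℝ)).hasFDerivAt.comp_hasDerivAt r h

variable {E : Type*} [NormedAddCommGroup E] [NormedSpace ℝ E] {n : WithTop ℕ∞}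

theorem contDiffAt_transpose {X : E → Matrix m m ℝ} {p : E} (h : ContDiffAt ℝ n X p) :
    ContDiffAt ℝ n (fun q => (X q)ᵀ) p :=
  (LinearMap.toContinuousLinearMap
    (Matrix.transposeLinearEquiv m m ℝ ℝ).toLinearMap).contDiff.contDiffAt.comp p h

theorem contDiffAt_trace {X : E → Matrix m m ℝ} {p : E} (h : ContDiffAt ℝ n X p) :
    ContDiffAt ℝ n (fun q => (X q).trace) p :=
  (LinearMap.toContinuousLinearMap (Matrix.traceLinearMap m ℝ ℝ)).contDiff.contDiffAt.comp p h

theorem continuous_riccati {Z : Type*} [TopologicalSpace Z] {A C P X : Z → Matrix m m ℝ}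
    (hA : Continuous A) (hC : Continuous C) (hP : Continuous P) (hX : Continuous X) :
    Continuous fun z => riccati (A z) (C z) (P z) (X z) :=
  (((hA.matrix_mul hX).add (hX.matrix_mul hA.matrix_transpose)).sub
    ((hX.matrix_mul hC).matrix_mul hX)).add hP

theorem contDiffAt_riccati {A C P X : E → Matrix m m ℝ} {p : E} (hA : ContDiffAt ℝ n A p)
    (hC : ContDiffAt ℝ n C p) (hP : ContDiffAt ℝ n P p) (hX : ContDiffAt ℝ n X p) :
    ContDiffAt ℝ n (fun q => riccati (A q) (C q) (P q) (X q)) p := by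
  classical
  exact (((hA.mul hX).add (hX.mul (contDiffAt_transpose hA))).sub ((hX.mul hC).mul hX)).add hP

theorem hasDerivAt_riccati {C X : ℝ → Matrix m m ℝ} {C' X' : Matrix m m ℝ} {r : ℝ}
    (A P : Matrix m m ℝ) (hC : HasDerivAt C C' r) (hX : HasDerivAt X X' r)
    (hCs : (C r).IsSymm) (hXs : (X r).IsSymm) :
    HasDerivAt (fun s => riccati A (C s) P (X s))
      (lyapunov (closedLoop A (C r) (X r)) X' - X r * C' * X r) r := by
  classical
  have h := (((hX.const_mul A).add (hX.mul_const Aᵀ)).sub ((hX.mul hC).mul hX)).add_const P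
  refine h.congr_deriv ?_
  rw [lyapunov_closedLoop hCs hXs, Pi.mul_apply]
  noncomm_ring

theorem fderiv_riccati_apply {A C P : E → Matrix m m ℝ} {X D : Matrix m m ℝ} {p : E}
    (hf : DifferentiableAt ℝ
      (fun z : E × Matrix m m ℝ => riccati (A z.1) (C z.1) (P z.1) z.2) (p, X))
    (hC : (C p).IsSymm) (hX : X.IsSymm) :
    fderiv ℝ (fun z : E × Matrix m m ℝ => riccati (A z.1) (C z.1) (P z.1) z.2) (p, X) (0, D) =
      lyapunov (closedLoop (A p) (C p) X) D := by
  have hX' : HasDerivAt (fun t : ℝ => X + t • D) D 0 :=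
    (hasDerivAt_smul_const D 0).const_add X
  have hline : HasDerivAt (fun t : ℝ => (p, X + t • D)) (0, D) 0 :=
    (hasDerivAt_const 0 p).prodMk hX'
  have hcomp := hf.hasFDerivAt.comp_hasDerivAt_of_eq 0 hline (by simp)
  have hcurve := hasDerivAt_riccati (A p) (P p) (hasDerivAt_const (0 : ℝ) (C p)) hX' hC
    (by simpa using hX)
  rw [mul_zero, zero_mul, sub_zero, zero_smul, add_zero] at hcurve
  exact hcomp.unique hcurve

/- The implicit function need not be symmetric a priori, but its transpose solves the same
equation near the same point. -/
theorem exists_contDiffAt_riccati_solution [CompleteSpace E] (hn : n ≠ 0)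
    {A C P : E → Matrix m m ℝ} {X₀ : Matrix m m ℝ} {p₀ : E} (hA : ContDiffAt ℝ n A p₀)
    (hC : ContDiffAt ℝ n C p₀) (hP : ContDiffAt ℝ n P p₀) (hCs : ∀ p, (C p).IsSymm)
    (hPs : ∀ p, (P p).IsSymm) (hC₀ : (C p₀).PosSemidef) (hP₀ : (P p₀).PosDef) (hX₀ : X₀.PosDef)
    (h₀ : riccati (A p₀) (C p₀) (P p₀) X₀ = 0) :
    ∃ X : E → Matrix m m ℝ, X p₀ = X₀ ∧ ContDiffAt ℝ n X p₀ ∧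
      ∀ᶠ p in 𝓝 p₀, (X p).PosDef ∧ riccati (A p) (C p) (P p) (X p) = 0 := by
  have hX₀s := isSymm_of_posDef hX₀
  have hf : ContDiffAt ℝ n
      (fun z : E × Matrix m m ℝ => riccati (A z.1) (C z.1) (P z.1) z.2) (p₀, X₀) :=
    contDiffAt_riccati (hA.comp (p₀, X₀) contDiffAt_fst) (hC.comp (p₀, X₀) contDiffAt_fst)
      (hP.comp (p₀, X₀) contDiffAt_fst) contDiffAt_snd
  obtain ⟨X, hXp, hX, hiff⟩ := exists_implicit_function hn hf fun D hD =>
    (isLyapunovStable_closedLoop hC₀ hP₀ hX₀ h₀).eq_zero_of_lyapunov_eq_zero <|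
      (fderiv_riccati_apply (hf.differentiableAt hn) (hCs p₀) hX₀s).symm.trans hD
  simp only [h₀] at hXp hX hiff
  have hlim : Tendsto X (𝓝 p₀) (𝓝 X₀) := hXp ▸ hX.continuousAt
  have hlimt : Tendsto (fun p => (X p)ᵀ) (𝓝 p₀) (𝓝 X₀) := by
    have htr : Continuous fun Y : Matrix m m ℝ => Yᵀ := continuous_id.matrix_transpose
    have h := (htr.tendsto X₀).comp hlim
    rw [hX₀s.eq] at h
    exact h
  refine ⟨X, hXp, hX, ?_⟩
  filter_upwards [(tendsto_id.prodMk_nhds hlim).eventually hiff,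
    (tendsto_id.prodMk_nhds hlimt).eventually hiff,
    hlim.eventually (eventually_posDef hX₀)] with p hp hpt hpos
  have hsol : riccati (A p) (C p) (P p) (X p) = 0 := hp.2 rfl
  have hsolt : riccati (A p) (C p) (P p) (X p)ᵀ = 0 := by
    rw [← transpose_riccati (hCs p) (hPs p), hsol, Matrix.transpose_zero]
  exact ⟨hpos (hpt.1 hsolt).symm, hsol⟩

end Smooth

/-! ### Riccati solutions as functions of the observation gain -/

section Bound

theorem isClosed_posSemidef {m : Type*} [Finite m] :
    IsClosed {X : Matrix m m ℝ | X.PosSemidef} := by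
  have := Fintype.ofFinite m
  have h : {X : Matrix m m ℝ | X.PosSemidef} =
      {X | Xᵀ = X} ∩ ⋂ x : m → ℝ, {X | 0 ≤ x ⬝ᵥ X *ᵥ x} := by
    ext X
    simp [Matrix.posSemidef_iff_dotProduct_mulVec, Matrix.isHermitian_iff_isSymm, Matrix.IsSymm]
  rw [h]
  exact (isClosed_eq continuous_id.matrix_transpose continuous_id).inter <|
    isClosed_iInter fun x => isClosed_le continuous_const
      (continuous_const.dotProduct (continuous_id.matrix_mulVec continuous_const))

theorem abs_apply_le_of_posSemidef {m : Type*} [Finite m] {X : Matrix m m ℝ}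
    (hX : X.PosSemidef) (i j : m) : |X i j| ≤ (X i i + X j j) / 2 := by
  classical
  have := Fintype.ofFinite m
  have hs : X j i = X i j := (isSymm_of_posSemidef hX).apply i j
  have hadd := hX.dotProduct_mulVec_nonneg (Pi.single i 1 + Pi.single j 1)
  have hsub := hX.dotProduct_mulVec_nonneg (Pi.single i 1 - Pi.single j 1)
  simp only [star_trivial, Matrix.mulVec_add, Matrix.mulVec_sub, add_dotProduct, sub_dotProduct,
    dotProduct_add, dotProduct_sub, Matrix.mulVec_single_one, single_one_dotProduct,
    Matrix.col_apply, hs] at hadd hsub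
  rw [abs_le]
  constructor <;> linarith

variable {m : Type*} [Fintype m]

theorem isCompact_posSemidef_trace_le (K : ℝ) :
    IsCompact {X : Matrix m m ℝ | X.PosSemidef ∧ X.trace ≤ K} := by
  have hbox : IsCompact
      (univ.pi fun _ => univ.pi fun _ => Icc (-K) K : Set (m → m → ℝ)) :=
    isCompact_univ_pi fun _ => isCompact_univ_pi fun _ => isCompact_Icc
  refine hbox.of_isClosed_subset (isClosed_posSemidef.inter
    (isClosed_le continuous_id.matrix_trace continuous_const)) ?_
  rintro X ⟨hX, hK⟩ i - j -
  have hdiag (k : m) : X k k ≤ K :=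
    (Finset.single_le_sum (f := fun k => X k k) (fun k _ => hX.diag_nonneg)
      (Finset.mem_univ k)).trans hK
  exact abs_le.1 ((abs_apply_le_of_posSemidef hX i j).trans (by linarith [hdiag i, hdiag j]))

/- `s • X` is a subsolution of the equation with gain `r₀`, since
`riccati A (r₀ • C) P (s • X) = s (r - r₀ s) X C X + (1 - s) P`. -/
theorem posSemidef_sub_smul_of_riccati {A C P X₀ X : Matrix m m ℝ} (hC : C.PosSemidef)
    (hP : P.PosDef) {r₀ r s : ℝ} (hr₀ : 0 ≤ r₀) (hs₀ : 0 ≤ s) (hs₁ : s ≤ 1) (hsr : r₀ * s ≤ r)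
    (hX₀ : X₀.PosDef) (h₀ : riccati A (r₀ • C) P X₀ = 0) (hX : X.IsSymm)
    (h : riccati A (r • C) P X = 0) : (X₀ - s • X).PosSemidef := by
  have hsub : riccati A (r₀ • C) P (s • X) = (s * (r - r₀ * s)) • (X * C * X) + (1 - s) • P := by
    have hsolve : riccati A (r₀ • C) P (s • X) =
        s • riccati A (r • C) P X + (s * (r - r₀ * s)) • (X * C * X) + (1 - s) • P := by
      simp only [riccati, Matrix.mul_smul, Matrix.smul_mul, smul_smul]
      module
    rw [hsolve, h, smul_zero, zero_add]
  refine posSemidef_sub_of_riccati_posSemidef (hC.smul hr₀) hP hX₀ h₀ (hX.smul s) ?_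
  rw [hsub]
  exact ((posSemidef_mul_mul_of_isSymm hC hX).smul (mul_nonneg hs₀ (sub_nonneg.2 hsr))).add
    (hP.posSemidef.smul (sub_nonneg.2 hs₁))

end Bound

section Existence

variable {m : Type*} [Fintype m] {A C P : Matrix m m ℝ}

theorem eventually_exists_riccati_smul_solution (hC : C.PosSemidef) (hP : P.PosDef)
    {X : Matrix m m ℝ} {r : ℝ} (hr : 0 ≤ r) (hX : X.PosDef) (h : riccati A (r • C) P X = 0) :
    ∀ᶠ s in 𝓝 r, ∃ Y : Matrix m m ℝ, Y.PosDef ∧ riccati A (s • C) P Y = 0 := by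
  open scoped Matrix.Norms.Operator in
  obtain ⟨Y, -, -, hY⟩ := exists_contDiffAt_riccati_solution (E := ℝ) (n := 1) one_ne_zero
    (A := fun _ => A) (C := fun s => s • C) (P := fun _ => P) contDiffAt_const
    (contDiffAt_id.smul contDiffAt_const) contDiffAt_const
    (fun s => (isSymm_of_posSemidef hC).smul s) (fun _ => isSymm_of_posDef hP) (hC.smul hr) hP hX h
  exact hY.mono fun s hs => ⟨Y s, hs⟩

theorem exists_riccati_smul_solution_of_frequently (hC : C.PosSemidef) (hP : P.PosDef)
    {X₀ : Matrix m m ℝ} {r₀ : ℝ} (hr₀ : 0 < r₀) (hX₀ : X₀.PosDef)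
    (h₀ : riccati A (r₀ • C) P X₀ = 0) {r : ℝ} (hr : 0 < r)
    (h : ∃ᶠ s in 𝓝 r, ∃ X : Matrix m m ℝ, X.PosDef ∧ riccati A (s • C) P X = 0) :
    ∃ X : Matrix m m ℝ, X.PosDef ∧ riccati A (r • C) P X = 0 := by
  obtain ⟨q, hq₀, hq₁, hqr⟩ : ∃ q > 0, q ≤ 1 ∧ r₀ * q ≤ r / 2 :=
    ⟨min 1 (r / 2 / r₀), by positivity, min_le_left _ _,
      (le_div_iff₀' hr₀).1 (min_le_right _ _)⟩
  set Z : Set (ℝ × Matrix m m ℝ) :=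
    (Icc (r / 2) (r + 1) ×ˢ {X | X.PosSemidef ∧ X.trace ≤ X₀.trace / q}) ∩
      {z | riccati A (z.1 • C) P z.2 = 0}
  have hZ : IsCompact Z :=
    (isCompact_Icc.prod (isCompact_posSemidef_trace_le _)).inter_right <|
      isClosed_eq (continuous_riccati continuous_const (continuous_fst.smul continuous_const)
        continuous_const continuous_snd) continuous_const
  have hmem : r ∈ Prod.fst '' Z := by
    rw [← (hZ.image continuous_fst).isClosed.closure_eq, mem_closure_iff_frequently]
    refine (h.and_eventually (Icc_mem_nhds (half_lt_self hr) (lt_add_one r))).mono ?_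
    rintro s ⟨⟨X, hX, hXs⟩, hs⟩
    refine ⟨(s, X), ⟨⟨hs, hX.posSemidef, ?_⟩, hXs⟩, rfl⟩
    have htrace := (posSemidef_sub_smul_of_riccati hC hP hr₀.le hq₀.le hq₁ (hqr.trans hs.1) hX₀ h₀
      (isSymm_of_posDef hX) hXs).trace_nonneg
    rw [Matrix.trace_sub, Matrix.trace_smul, smul_eq_mul, sub_nonneg] at htrace
    exact (le_div_iff₀' hq₀).2 htrace
  obtain ⟨⟨_, X⟩, ⟨⟨-, hX, -⟩, hXr⟩, rfl⟩ := hmem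
  exact ⟨X, posDef_of_posSemidef_of_riccati_eq_zero hP hX hXr, hXr⟩

theorem exists_riccati_smul_solution (hC : C.PosSemidef) (hP : P.PosDef)
    {X₀ : Matrix m m ℝ} {r₀ : ℝ} (hr₀ : 0 < r₀) (hX₀ : X₀.PosDef)
    (h₀ : riccati A (r₀ • C) P X₀ = 0) {r : ℝ} (hr : 0 < r) :
    ∃ X : Matrix m m ℝ, X.PosDef ∧ riccati A (r • C) P X = 0 := by
  set U : Set ℝ := {s | 0 < s ∧ ∃ X : Matrix m m ℝ, X.PosDef ∧ riccati A (s • C) P X = 0}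
  suffices hU : Ioi (0 : ℝ) ⊆ U from (hU hr).2
  refine isPreconnected_Ioi.subset_of_closure_inter_subset (isOpen_iff_mem_nhds.2 ?_)
    ⟨r₀, hr₀, hr₀, X₀, hX₀, h₀⟩ ?_
  · rintro s ⟨hs, X, hX, hXs⟩
    exact (lt_mem_nhds hs).and (eventually_exists_riccati_smul_solution hC hP hs.le hX hXs)
  · rintro s ⟨hsU, hs⟩
    exact ⟨hs, exists_riccati_smul_solution_of_frequently hC hP hr₀ hX₀ h₀ hs
      ((mem_closure_iff_frequently.1 hsU).mono fun _ h => h.2)⟩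

end Existence

section Convexity

variable {m : Type*} [Fintype m] {A C P : Matrix m m ℝ}

/-- `X r` is the stabilizing solution of the Riccati equation with observation matrix `r • C`,
for every gain `r > 0`; its values at `r ≤ 0` are irrelevant. -/
def IsGainFamily (A C P : Matrix m m ℝ) (X : ℝ → Matrix m m ℝ) : Prop :=
  ∀ r, 0 < r → (X r).PosDef ∧ riccati A (r • C) P (X r) = 0

theorem lyapunov_mul_inv_mul [DecidableEq m] {X : Matrix m m ℝ} (hX : IsUnit X)
    (F X₁ : Matrix m m ℝ) :
    lyapunov F (X₁ * X⁻¹ * X₁) = lyapunov F X₁ * X⁻¹ * X₁ + X₁ * X⁻¹ * lyapunov F X₁ -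
      X₁ * X⁻¹ * lyapunov F X * X⁻¹ * X₁ := by
  have hdet := (Matrix.isUnit_iff_isUnit_det _).1 hX
  have hleft : X₁ * X⁻¹ * (F * X) * X⁻¹ * X₁ = X₁ * X⁻¹ * F * X₁ := by
    simp only [mul_assoc, Matrix.mul_nonsing_inv_cancel_left _ _ hdet]
  have hright : X₁ * X⁻¹ * (X * Fᵀ) * X⁻¹ * X₁ = X₁ * Fᵀ * X⁻¹ * X₁ := by
    simp only [mul_assoc, Matrix.nonsing_inv_mul_cancel_left _ _ hdet]
  simp only [lyapunov, mul_add, add_mul, hleft, hright]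
  noncomm_ring

/- Here `X₁` and `X₂` stand for the first two derivatives of the solution with respect to the
gain; the difference solves a Lyapunov equation with right-hand side `-2 X₁ X⁻¹ P X⁻¹ X₁`. -/
theorem posSemidef_sub_two_smul_mul_inv_mul [DecidableEq m] {X X₁ X₂ : Matrix m m ℝ} {r : ℝ}
    (hr : 0 ≤ r) (hC : C.PosSemidef) (hP : P.PosDef) (hX : X.PosDef)
    (h : riccati A (r • C) P X = 0) (hX₁ : X₁.IsSymm) (hX₂ : X₂.IsSymm)
    (h₁ : lyapunov (closedLoop A (r • C) X) X₁ = X * C * X)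
    (h₂ : lyapunov (closedLoop A (r • C) X) X₂ =
      (2 : ℝ) • (X₁ * C * X + X * C * X₁ + X₁ * (r • C) * X₁)) :
    (X₂ - (2 : ℝ) • (X₁ * X⁻¹ * X₁)).PosSemidef := by
  have hdet := (Matrix.isUnit_iff_isUnit_det _).1 hX.isUnit
  have hself := lyapunov_closedLoop_self ((isSymm_of_posSemidef hC).smul r) (isSymm_of_posDef hX)
    A P
  have hFX := isLyapunovStable_closedLoop (hC.smul hr) hP hX h
  rw [h, zero_sub] at hself
  set F := closedLoop A (r • C) X
  set V := X₁ * X⁻¹ * X₁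
  have hY : (X₁ * X⁻¹ * P * X⁻¹ * X₁).PosSemidef := by
    have hPY := posSemidef_mul_mul_transpose hP.posSemidef (X₁ * X⁻¹)
    rwa [Matrix.transpose_mul, hX₁.eq, (isSymm_of_posDef hX.inv).eq, ← mul_assoc] at hPY
  have hV : lyapunov F V =
      X₁ * C * X + X * C * X₁ + X₁ * (r • C) * X₁ + X₁ * X⁻¹ * P * X⁻¹ * X₁ := by
    rw [lyapunov_mul_inv_mul hX.isUnit, h₁, hself]
    simp only [mul_add, add_mul, mul_neg, neg_mul, mul_assoc,
      Matrix.mul_nonsing_inv_cancel_left _ _ hdet, Matrix.nonsing_inv_mul_cancel_left _ _ hdet]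
    abel
  have hVs : V.IsSymm := by
    rw [Matrix.IsSymm, Matrix.transpose_mul, Matrix.transpose_mul, hX₁.eq,
      (isSymm_of_posDef hX.inv).eq, ← mul_assoc]
  refine hFX.posSemidef_of_lyapunov (hX₂.sub (hVs.smul 2)) ?_
  have hW : -lyapunov F (X₂ - (2 : ℝ) • V) = (2 : ℝ) • (X₁ * X⁻¹ * P * X⁻¹ * X₁) := by
    have hlin : lyapunov F (X₂ - (2 : ℝ) • V) = lyapunov F X₂ - (2 : ℝ) • lyapunov F V := by
      simp only [lyapunov, mul_sub, sub_mul, Matrix.mul_smul, Matrix.smul_mul]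
      module
    rw [hlin, h₂, hV]
    module
  rw [hW]
  exact hY.smul zero_le_two

theorem trace_pos_of_lyapunov_eq {X X₁ X₂ : Matrix m m ℝ} {r : ℝ}
    (hr : 0 ≤ r) (hC : C.PosSemidef) (hC0 : C ≠ 0) (hP : P.PosDef) (hX : X.PosDef)
    (h : riccati A (r • C) P X = 0) (hX₁ : X₁.IsSymm) (hX₂ : X₂.IsSymm)
    (h₁ : lyapunov (closedLoop A (r • C) X) X₁ = X * C * X)
    (h₂ : lyapunov (closedLoop A (r • C) X) X₂ =
      (2 : ℝ) • (X₁ * C * X + X * C * X₁ + X₁ * (r • C) * X₁)) :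
    0 < X₂.trace := by
  classical
  have hX₁0 : X₁ ≠ 0 := by
    rintro rfl
    rw [lyapunov, mul_zero, zero_mul, add_zero, eq_comm, mul_assoc] at h₁
    exact hC0 (hX.isUnit.mul_left_eq_zero.1 (hX.isUnit.mul_right_eq_zero.1 h₁))
  have hV : (X₁ * X⁻¹ * X₁).PosSemidef := posSemidef_mul_mul_of_isSymm hX.inv.posSemidef hX₁
  have hV0 : 0 < (X₁ * X⁻¹ * X₁).trace := hV.trace_nonneg.lt_of_ne' fun h0 => hX₁0 <|
    eq_zero_of_mul_mul_transpose_eq_zero hX.inv (hX₁.eq.symm ▸ hV.trace_eq_zero_iff.1 h0)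
  have hW := (posSemidef_sub_two_smul_mul_inv_mul hr hC hP hX h hX₁ hX₂ h₁ h₂).trace_nonneg
  rw [Matrix.trace_sub, Matrix.trace_smul, smul_eq_mul] at hW
  linarith

section Deriv

theorem differentiableAt_deriv_of_contDiffAt {G : Type*} [NormedAddCommGroup G] [NormedSpace ℝ G]
    {X : ℝ → G} {r : ℝ} (h : ContDiffAt ℝ 2 X r) : DifferentiableAt ℝ (deriv X) r := by
  have hfderiv : ContDiffAt ℝ 1 (fderiv ℝ X) r := h.fderiv_right (by norm_num)
  exact (hfderiv.differentiableAt one_ne_zero).clm_apply (differentiableAt_const 1)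

open scoped Matrix.Norms.Operator

variable {X : ℝ → Matrix m m ℝ}

theorem IsGainFamily.contDiffAt (hX : IsGainFamily A C P X) (hC : C.PosSemidef) (hP : P.PosDef)
    {n : WithTop ℕ∞} (hn : n ≠ 0) {r : ℝ} (hr : 0 < r) : ContDiffAt ℝ n X r := by
  obtain ⟨Y, -, hY, hYX⟩ := exists_contDiffAt_riccati_solution (E := ℝ) hn
    (A := fun _ => A) (C := fun s => s • C) (P := fun _ => P) contDiffAt_const
    (contDiffAt_id.smul contDiffAt_const) contDiffAt_const
    (fun s => (isSymm_of_posSemidef hC).smul s) (fun _ => isSymm_of_posDef hP)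
    (hC.smul hr.le) hP (hX r hr).1 (hX r hr).2
  refine hY.congr_of_eventuallyEq ?_
  filter_upwards [hYX, lt_mem_nhds hr] with s hs hs0
  exact riccati_solution_unique (hC.smul hs0.le) hP (hX s hs0).1 (hX s hs0).2 hs.1 hs.2

theorem IsGainFamily.hasDerivAt (hX : IsGainFamily A C P X) (hC : C.PosSemidef) (hP : P.PosDef)
    {r : ℝ} (hr : 0 < r) : HasDerivAt X (deriv X r) r :=
  ((hX.contDiffAt hC hP one_ne_zero hr).differentiableAt one_ne_zero).hasDerivAt

theorem IsGainFamily.hasDerivAt_deriv (hX : IsGainFamily A C P X) (hC : C.PosSemidef)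
    (hP : P.PosDef) {r : ℝ} (hr : 0 < r) : HasDerivAt (deriv X) (deriv (deriv X) r) r :=
  (differentiableAt_deriv_of_contDiffAt (hX.contDiffAt hC hP two_ne_zero hr)).hasDerivAt

theorem IsGainFamily.isSymm_deriv (hX : IsGainFamily A C P X) (hC : C.PosSemidef) (hP : P.PosDef)
    {r : ℝ} (hr : 0 < r) : (deriv X r).IsSymm :=
  isSymm_of_hasDerivAt (hX.hasDerivAt hC hP hr) <|
    (lt_mem_nhds hr).mono fun s hs => isSymm_of_posDef (hX s hs).1

theorem hasDerivAt_lyapunov {F Y : ℝ → Matrix m m ℝ} {F' Y' : Matrix m m ℝ} {r : ℝ}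
    (hF : HasDerivAt F F' r) (hY : HasDerivAt Y Y' r) :
    HasDerivAt (fun s => lyapunov (F s) (Y s)) (lyapunov F' (Y r) + lyapunov (F r) Y') r := by
  classical
  refine ((hF.mul hY).add (hY.mul (hasDerivAt_transpose hF))).congr_deriv ?_
  simp only [lyapunov]
  abel

theorem IsGainFamily.lyapunov_deriv (hX : IsGainFamily A C P X) (hC : C.PosSemidef)
    (hP : P.PosDef) {r : ℝ} (hr : 0 < r) :
    lyapunov (closedLoop A (r • C) (X r)) (deriv X r) = X r * C * X r := by
  have hderiv := hasDerivAt_riccati A P (hasDerivAt_smul_const C r) (hX.hasDerivAt hC hP hr)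
    ((isSymm_of_posSemidef hC).smul r) (isSymm_of_posDef (hX r hr).1)
  refine sub_eq_zero.1 (hderiv.unique ((hasDerivAt_const r 0).congr_of_eventuallyEq ?_))
  filter_upwards [lt_mem_nhds hr] with s hs using (hX s hs).2

theorem IsGainFamily.lyapunov_deriv_deriv (hX : IsGainFamily A C P X) (hC : C.PosSemidef)
    (hP : P.PosDef) {r : ℝ} (hr : 0 < r) :
    lyapunov (closedLoop A (r • C) (X r)) (deriv (deriv X) r) =
      (2 : ℝ) • (deriv X r * C * X r + X r * C * deriv X r +
        deriv X r * (r • C) * deriv X r) := by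
  classical
  have hX₁ := hX.hasDerivAt hC hP hr
  have hX₂ := hX.hasDerivAt_deriv hC hP hr
  have hF : HasDerivAt (fun s => closedLoop A (s • C) (X s))
      (-(deriv X r * (r • C) + X r * C)) r :=
    (hX₁.mul (hasDerivAt_smul_const C r)).const_sub A
  have hleft := hasDerivAt_lyapunov hF hX₂
  have hright := (hX₁.mul_const C).mul hX₁
  have h := hleft.unique (hright.congr_of_eventuallyEq ?_)
  · rw [← eq_sub_iff_add_eq'] at h
    rw [h, lyapunov, Matrix.transpose_neg, Matrix.transpose_add, Matrix.transpose_mul,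
      Matrix.transpose_mul, (hX.isSymm_deriv hC hP hr).eq, (isSymm_of_posDef (hX r hr).1).eq,
      ((isSymm_of_posSemidef hC).smul r).eq, (isSymm_of_posSemidef hC).eq]
    rw [two_smul]
    noncomm_ring
  · filter_upwards [lt_mem_nhds hr] with s hs using hX.lyapunov_deriv hC hP hs

theorem IsGainFamily.deriv_deriv_trace_pos (hX : IsGainFamily A C P X) (hC : C.PosSemidef)
    (hC0 : C ≠ 0) (hP : P.PosDef) {r : ℝ} (hr : 0 < r) :
    0 < deriv (deriv fun s => (X s).trace) r := by
  have hderiv : deriv (fun s => (X s).trace) =ᶠ[𝓝 r] fun s => (deriv X s).trace :=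
    (lt_mem_nhds hr).mono fun s hs => (hasDerivAt_trace (hX.hasDerivAt hC hP hs)).deriv
  have hX₂ := hX.hasDerivAt_deriv hC hP hr
  rw [hderiv.deriv_eq, (hasDerivAt_trace hX₂).deriv]
  have hX₂s : (deriv (deriv X) r).IsSymm := isSymm_of_hasDerivAt hX₂ <|
    (lt_mem_nhds hr).mono fun s hs => hX.isSymm_deriv hC hP hs
  exact trace_pos_of_lyapunov_eq hr.le hC hC0 hP (hX r hr).1 (hX r hr).2
    (hX.isSymm_deriv hC hP hr) hX₂s (hX.lyapunov_deriv hC hP hr) (hX.lyapunov_deriv_deriv hC hP hr)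

end Deriv

end Convexity

/-! ### Diagonally dominant matrices -/

section Dominance

variable {ι : Type*} [Fintype ι] [DecidableEq ι]

/-- A uniform form of diagonal dominance: every diagonal entry exceeds twice the sum of the
absolute values of the off-diagonal entries of any row. -/
def IsDiagDominant (H : Matrix ι ι ℝ) : Prop :=
  ∀ i k, 2 * ∑ j ∈ Finset.univ.erase i, |H i j| < H k k

namespace IsDiagDominant

variable {H : Matrix ι ι ℝ}

theorem diag_pos (h : IsDiagDominant H) (i : ι) : 0 < H i i :=
  (mul_nonneg zero_le_two (Finset.sum_nonneg fun _ _ => abs_nonneg _)).trans_lt (h i i)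

theorem posDef (h : IsDiagDominant H) (hH : H.IsSymm) : H.PosDef := by
  have hHerm : H.IsHermitian := Matrix.isHermitian_iff_isSymm.2 hH
  refine hHerm.posDef_iff_eigenvalues_pos.2 fun l => ?_
  have hl : Module.End.HasEigenvalue (Matrix.toLin' H) (hHerm.eigenvalues l) := by
    rw [Module.End.hasEigenvalue_iff_mem_spectrum, Matrix.spectrum_toLin']
    exact hHerm.eigenvalues_mem_spectrum_real l
  obtain ⟨k, hk⟩ := eigenvalue_mem_ball hl
  rw [Metric.mem_closedBall, Real.dist_eq] at hk
  simp only [Real.norm_eq_abs] at hk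
  linarith [(abs_le.1 hk).1, h k k, h.diag_pos k]

theorem abs_sum_erase_le (h : IsDiagDominant H) {v : ι → ℝ} {k : ι} (hk : ∀ j, |v j| ≤ |v k|)
    (hk0 : v k ≠ 0) (i : ι) : 2 * |∑ j ∈ Finset.univ.erase i, H i j * v j| < H k k * |v k| :=
  calc 2 * |∑ j ∈ Finset.univ.erase i, H i j * v j|
    _ ≤ 2 * ∑ j ∈ Finset.univ.erase i, |H i j| * |v k| := by
      gcongr
      refine (Finset.abs_sum_le_sum_abs _ _).trans (Finset.sum_le_sum fun j _ => ?_)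
      rw [abs_mul]
      exact mul_le_mul_of_nonneg_left (hk j) (abs_nonneg _)
    _ = (2 * ∑ j ∈ Finset.univ.erase i, |H i j|) * |v k| := by rw [← Finset.sum_mul, mul_assoc]
    _ < H k k * |v k| := mul_lt_mul_of_pos_right (h i k) (abs_pos.2 hk0)

theorem pos_of_mulVec_eq (h : IsDiagDominant H) {v : ι → ℝ} {J : Set ι} {a : ℝ} (ha : 0 < a)
    (hJ : ∀ i ∈ J, (H *ᵥ v) i = a) (hJ' : ∀ i ∉ J, v i = 0) {i : ι} (hi : i ∈ J) : 0 < v i := by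
  have hsplit (l : ι) : (H *ᵥ v) l = H l l * v l + ∑ j ∈ Finset.univ.erase l, H l j * v j :=
    (Finset.add_sum_erase _ _ (Finset.mem_univ l)).symm
  obtain ⟨k, -, hk⟩ := Finset.univ.exists_max_image (fun k => |v k|) ⟨i, Finset.mem_univ i⟩
  have hk0 : v k ≠ 0 := fun hk0 => ha.ne <| by
    have hv : v = 0 := funext fun j => by simpa [hk0] using hk j (Finset.mem_univ j)
    rw [← hJ i hi, hv, Matrix.mulVec_zero, Pi.zero_apply]
  have hoff := h.abs_sum_erase_le (fun j => hk j (Finset.mem_univ j)) hk0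
  have hdiag : H k k * |v k| ≤ a + |∑ j ∈ Finset.univ.erase k, H k j * v j| := by
    have hrow := hJ k (not_imp_comm.1 (hJ' k) hk0)
    rw [hsplit] at hrow
    rw [← abs_of_pos (h.diag_pos k), ← abs_mul, eq_sub_of_add_eq hrow]
    exact (abs_sub _ _).trans_eq (by rw [abs_of_pos ha])
  have hrow := hJ i hi
  rw [hsplit] at hrow
  have hpos : 0 < H i i * v i := by
    linarith [hoff i, hoff k, le_abs_self (∑ j ∈ Finset.univ.erase i, H i j * v j)]
  exact pos_of_mul_pos_right hpos (h.diag_pos i).le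

end IsDiagDominant

end Dominance

/-! ### Simplices -/

section Simplex

variable {N : ℕ} {σ σmax : ℝ} {v : Fin N → ℝ}

theorem mem_Ch : v ∈ Ch N σmax ↔ (∀ i, 0 ≤ v i) ∧ ∑ i, v i ≤ σmax := by
  simp only [Ch, Sp, mem_iUnion, Set.mem_ofPred_eq, exists_prop]
  constructor
  · rintro ⟨σ, hσ, h0, hs⟩
    exact ⟨h0, hs.trans_le hσ.2⟩
  · rintro ⟨h0, hs⟩
    exact ⟨_, ⟨Finset.sum_nonneg fun i _ => h0 i, hs⟩, h0, rfl⟩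

theorem Sp_subset_Ch (h : σ ≤ σmax) : Sp N σ ⊆ Ch N σmax :=
  fun _ hv => mem_Ch.2 ⟨hv.1, hv.2.trans_le h⟩

theorem add_pos_of_mem_Ch {r : ℝ} (hr : 0 < r) (hv : v ∈ Ch N σmax) (i : Fin N) : 0 < v i + r :=
  add_pos_of_nonneg_of_pos ((mem_Ch.1 hv).1 i) hr

theorem isCompact_Ch (N : ℕ) (σmax : ℝ) : IsCompact (Ch N σmax) := by
  have hCh : Ch N σmax = Icc 0 (fun _ => σmax) ∩ {v | ∑ i, v i ≤ σmax} := by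
    ext v
    rw [mem_Ch]
    refine ⟨fun h => ⟨⟨h.1, fun i => ?_⟩, h.2⟩, fun h => ⟨h.1.1, h.2⟩⟩
    exact (Finset.single_le_sum (fun j _ => h.1 j) (Finset.mem_univ i)).trans h.2
  rw [hCh]
  exact isCompact_Icc.inter_right (isClosed_le (by fun_prop) continuous_const)

theorem isCompact_Sp (N : ℕ) (σ : ℝ) : IsCompact (Sp N σ) := by
  have hSp : Sp N σ = Ch N σ ∩ {v | ∑ i, v i = σ} := by
    ext v
    exact ⟨fun h => ⟨Sp_subset_Ch le_rfl h, h.2⟩, fun h => ⟨(mem_Ch.1 h.1).1, h.2⟩⟩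
  rw [hSp]
  exact (isCompact_Ch N σ).inter_right (isClosed_eq (by fun_prop) continuous_const)

theorem convex_Sp (N : ℕ) (σ : ℝ) : Convex ℝ (Sp N σ) := by
  intro x hx y hy a b ha hb hab
  refine ⟨fun i => add_nonneg (mul_nonneg ha (hx.1 i)) (mul_nonneg hb (hy.1 i)), ?_⟩
  simp only [Pi.add_apply, Pi.smul_apply, smul_eq_mul, Finset.sum_add_distrib, ← Finset.mul_sum,
    hx.2, hy.2, ← add_mul, hab, one_mul]

theorem nonempty_Sp (hN : 1 ≤ N) (hσ : 0 ≤ σ) : (Sp N σ).Nonempty :=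
  have h : (0 : Fin N → ℝ) ≤ Pi.single ⟨0, hN⟩ σ := Pi.single_nonneg.2 hσ
  ⟨_, h, by simp⟩

theorem add_smul_single_sub_single_mem_Sp (hv : v ∈ Sp N σ) {i j : Fin N} :
    v + v i • (Pi.single j 1 - Pi.single i 1) ∈ Sp N σ := by
  refine ⟨fun k => ?_, by simp [Finset.sum_add_distrib, ← Finset.mul_sum, hv.2]⟩
  have hi := hv.1 i
  have hk := hv.1 k
  simp only [Pi.add_apply, Pi.smul_apply, Pi.sub_apply, Pi.single_apply, smul_eq_mul]
  split_ifs with hkj hki hki <;> first | subst hki; linarith | linarith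

end Simplex

/-! ### Gradients, Hessians and multipliers -/

section Optimization

variable {ι : Type*} [Fintype ι] [DecidableEq ι] {η : (ι → ℝ) → ℝ} {x v : ι → ℝ}

/-- The vector of the partial derivatives of `η` at `x`. -/
def grad (η : (ι → ℝ) → ℝ) (x : ι → ℝ) : ι → ℝ :=
  fun i => fderiv ℝ η x (Pi.single i 1)

/-- The Hessian of `η` at `x`: the Jacobian matrix of the gradient. -/
def hessian (η : (ι → ℝ) → ℝ) (x : ι → ℝ) : Matrix ι ι ℝ :=
  LinearMap.toMatrix' (fderiv ℝ (grad η) x : (ι → ℝ) →ₗ[ℝ] ι → ℝ)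

theorem fderiv_apply_eq_dotProduct_grad (η : (ι → ℝ) → ℝ) (x v : ι → ℝ) :
    fderiv ℝ η x v = v ⬝ᵥ grad η x := by
  conv_lhs => rw [pi_eq_sum_univ' v]
  simp only [map_sum, map_smul, smul_eq_mul, dotProduct, grad]

theorem hessian_mulVec (η : (ι → ℝ) → ℝ) (x v : ι → ℝ) :
    hessian η x *ᵥ v = fderiv ℝ (grad η) x v :=
  LinearMap.toMatrix'_mulVec _ _

theorem hessian_apply (η : (ι → ℝ) → ℝ) (x : ι → ℝ) (i j : ι) :
    hessian η x i j = fderiv ℝ (grad η) x (Pi.single j 1) i :=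
  LinearMap.toMatrix'_apply _ _ _

theorem contDiffAt_grad (h : ContDiffAt ℝ 2 η x) : ContDiffAt ℝ 1 (grad η) x :=
  contDiffAt_pi.2 fun _ => (h.fderiv_right (by norm_num)).clm_apply contDiffAt_const

theorem isSymm_hessian (h : ContDiffAt ℝ 2 η x) : (hessian η x).IsSymm := by
  have hd : DifferentiableAt ℝ (fderiv ℝ η) x :=
    (h.fderiv_right (m := 1) (by norm_num)).differentiableAt one_ne_zero
  have happly (i j : ι) : hessian η x i j =
      fderiv ℝ (fderiv ℝ η) x (Pi.single j 1) (Pi.single i 1) := by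
    have hg : HasFDerivAt (grad η) (ContinuousLinearMap.pi fun i =>
        (fderiv ℝ (fderiv ℝ η) x).flip (Pi.single i 1)) x :=
      hasFDerivAt_pi.2 fun i => by
        simpa [grad] using hd.hasFDerivAt.clm_apply (hasFDerivAt_const (Pi.single i (1 : ℝ)) x)
    rw [hessian_apply, hg.fderiv]
    rfl
  refine Matrix.IsSymm.ext fun i j => ?_
  rw [happly, happly]
  exact (h.isSymmSndFDerivAt (by simp)).eq _ _

theorem hasDerivAt_grad_comp {c : ℝ → ι → ℝ} {t : ℝ} (hη : ContDiffAt ℝ 2 η (c t))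
    (hc : HasDerivAt c v t) : HasDerivAt (fun s => grad η (c s)) (hessian η (c t) *ᵥ v) t := by
  rw [hessian_mulVec]
  exact ((contDiffAt_grad hη).differentiableAt one_ne_zero).hasFDerivAt.comp_hasDerivAt t hc

theorem lt_of_deriv_nonneg_of_deriv_deriv_pos {φ φ' φ'' : ℝ → ℝ} {a b : ℝ} (hab : a < b)
    (h₁ : ∀ t ∈ Icc a b, HasDerivAt φ (φ' t) t) (h₂ : ∀ t ∈ Icc a b, HasDerivAt φ' (φ'' t) t)
    (hpos : ∀ t ∈ Ioo a b, 0 < φ'' t) (ha : 0 ≤ φ' a) : φ a < φ b := by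
  have hφ' : StrictMonoOn φ' (Icc a b) :=
    strictMonoOn_of_deriv_pos (convex_Icc a b) (HasDerivAt.continuousOn h₂) fun t ht => by
      rw [(h₂ t (interior_subset ht)).deriv]
      exact hpos t (by rwa [interior_Icc] at ht)
  have hφ : StrictMonoOn φ (Icc a b) :=
    strictMonoOn_of_deriv_pos (convex_Icc a b) (HasDerivAt.continuousOn h₁) fun t ht => by
      rw [(h₁ t (interior_subset ht)).deriv]
      refine ha.trans_lt (hφ' (left_mem_Icc.2 hab.le) (interior_subset ht) ?_)
      rw [interior_Icc] at ht
      exact ht.1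
  exact hφ (left_mem_Icc.2 hab.le) (right_mem_Icc.2 hab.le) hab

theorem lt_of_posDef_hessian {K : Set (ι → ℝ)} (hK : Convex ℝ K)
    (hη : ∀ z ∈ K, ContDiffAt ℝ 2 η z) (hH : ∀ z ∈ K, (hessian η z).PosDef)
    {x y : ι → ℝ} (hx : x ∈ K) (hy : y ∈ K) (hne : y ≠ x) (hd : 0 ≤ (y - x) ⬝ᵥ grad η x) :
    η x < η y := by
  have hline (t : ℝ) : HasDerivAt (AffineMap.lineMap x y) (y - x) t := AffineMap.hasDerivAt_lineMap
  have hmem (t : ℝ) (ht : t ∈ Icc 0 1) : AffineMap.lineMap x y t ∈ K := hK.lineMap_mem hx hy ht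
  have h := lt_of_deriv_nonneg_of_deriv_deriv_pos zero_lt_one
    (φ := fun t : ℝ => η (AffineMap.lineMap x y t))
    (φ' := fun t => (y - x) ⬝ᵥ grad η (AffineMap.lineMap x y t))
    (φ'' := fun t => (y - x) ⬝ᵥ (hessian η (AffineMap.lineMap x y t) *ᵥ (y - x)))
    (fun t ht => ?_) (fun t ht => ?_) (fun t ht => ?_) (by rwa [AffineMap.lineMap_apply_zero])
  · simpa only [AffineMap.lineMap_apply_zero, AffineMap.lineMap_apply_one] using h
  · rw [← fderiv_apply_eq_dotProduct_grad]
    exact ((hη _ (hmem t ht)).differentiableAt two_ne_zero).hasFDerivAt.comp_hasDerivAt t (hline t)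
  · exact HasDerivAt.fun_sum fun i _ => (hasDerivAt_pi.1
      (hasDerivAt_grad_comp (hη _ (hmem t ht)) (hline t)) i).const_mul ((y - x) i)
  · exact (hH _ (hmem t (Ioo_subset_Icc_self ht))).dotProduct_mulVec_pos (sub_ne_zero.2 hne)

/-- `μ` is the largest number satisfying the Karush–Kuhn–Tucker conditions of the minimization of
`η` over a simplex at the point `x`: it is the least partial derivative, and every partial
derivative in the direction of a positive entry of `x` equals it. -/
def IsLargestKKTMultiplier (η : (ι → ℝ) → ℝ) (x : ι → ℝ) (μ : ℝ) : Prop :=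
  IsLeast (range (grad η x)) μ ∧ ∀ i, 0 < x i → grad η x i = μ

end Optimization

section SimplexOptimization

variable {N : ℕ} {η : (Fin N → ℝ) → ℝ} {σ μ : ℝ} {x : Fin N → ℝ}

theorem IsLargestKKTMultiplier.dotProduct_grad_nonneg (h : IsLargestKKTMultiplier η x μ)
    (hx : x ∈ Sp N σ) {y : Fin N → ℝ} (hy : y ∈ Sp N σ) : 0 ≤ (y - x) ⬝ᵥ grad η x := by
  have hle (i : Fin N) : (y - x) i * μ ≤ (y - x) i * grad η x i := by
    rcases (hx.1 i).eq_or_lt with hi | hi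
    · have hyx : 0 ≤ (y - x) i := by
        rw [Pi.sub_apply, ← hi, sub_zero]
        exact hy.1 i
      exact mul_le_mul_of_nonneg_left (h.1.2 ⟨i, rfl⟩) hyx
    · rw [h.2 i hi]
  calc 0 = ∑ i, (y - x) i * μ := by
        simp only [← Finset.sum_mul, Pi.sub_apply, Finset.sum_sub_distrib, hx.2, hy.2, sub_self,
          zero_mul]
    _ ≤ (y - x) ⬝ᵥ grad η x := Finset.sum_le_sum fun i _ => hle i

theorem IsLargestKKTMultiplier.lt_of_ne (h : IsLargestKKTMultiplier η x μ)
    (hη : ∀ z ∈ Sp N σ, ContDiffAt ℝ 2 η z) (hH : ∀ z ∈ Sp N σ, (hessian η z).PosDef)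
    (hx : x ∈ Sp N σ) {y : Fin N → ℝ} (hy : y ∈ Sp N σ) (hne : y ≠ x) : η x < η y :=
  lt_of_posDef_hessian (convex_Sp N σ) hη hH hx hy hne (h.dotProduct_grad_nonneg hx hy)

theorem grad_le_of_isMinOn (hx : x ∈ Sp N σ) (hmin : IsMinOn η (Sp N σ) x)
    (hd : DifferentiableAt ℝ η x) {i : Fin N} (hi : 0 < x i) (j : Fin N) :
    grad η x i ≤ grad η x j := by
  have hslope := hmin.localize.hasFDerivWithinAt_nonneg hd.hasFDerivAt.hasFDerivWithinAt
    (sub_mem_posTangentConeAt_of_segment_subset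
      ((convex_Sp N σ).segment_subset hx (add_smul_single_sub_single_mem_Sp hx (i := i) (j := j))))
  rw [add_sub_cancel_left, map_smul, map_sub, smul_eq_mul] at hslope
  exact sub_nonneg.1 (nonneg_of_mul_nonneg_right hslope hi)

theorem exists_isLargestKKTMultiplier_of_isMinOn (hN : 1 ≤ N) (hx : x ∈ Sp N σ)
    (hmin : IsMinOn η (Sp N σ) x) (hd : DifferentiableAt ℝ η x) :
    ∃ μ, IsLargestKKTMultiplier η x μ := by
  have : Nonempty (Fin N) := ⟨⟨0, hN⟩⟩
  obtain ⟨k, hk⟩ := Finite.exists_min (grad η x)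
  exact ⟨grad η x k, ⟨mem_range_self k, forall_mem_range.2 hk⟩,
    fun i hi => (grad_le_of_isMinOn hx hmin hd hi k).antisymm (hk i)⟩

end SimplexOptimization

/-! ### The curve of Karush–Kuhn–Tucker points -/

section ActiveSystem

variable {ι : Type*} [Fintype ι] {g : (ι → ℝ) → ι → ℝ} {J : Set ι}

open scoped Classical in
/-- The map whose zeros `(s, x, μ)` are the points `x` of total `s` supported on `J` at which all
components of the vector field `g` along `J` are equal to `μ`. It is used for the gradient of the
function to be minimized, and for its linearization. -/
def activeSystem (g : (ι → ℝ) → ι → ℝ) (J : Set ι) (z : ℝ × (ι → ℝ) × ℝ) : (ι → ℝ) × ℝ :=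
  (fun i => if i ∈ J then g z.2.1 i - z.2.2 else z.2.1 i, ∑ i, z.2.1 i - z.1)

theorem activeSystem_eq_zero_iff {s μ : ℝ} {x : ι → ℝ} :
    activeSystem g J (s, x, μ) = 0 ↔
      (∀ i ∈ J, g x i = μ) ∧ (∀ i ∉ J, x i = 0) ∧ ∑ i, x i = s := by
  simp only [activeSystem, Prod.mk_eq_zero, funext_iff, Pi.zero_apply, sub_eq_zero]
  rw [← and_assoc]
  refine and_congr_left fun _ => ⟨fun h => ⟨fun i hi => ?_, fun i hi => ?_⟩, fun h i => ?_⟩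
  · simpa only [if_pos hi, sub_eq_zero] using h i
  · simpa only [if_neg hi] using h i
  · split_ifs with hi
    · exact sub_eq_zero.2 (h.1 i hi)
    · exact h.2 i hi

theorem contDiffAt_activeSystem {n : WithTop ℕ∞} {z : ℝ × (ι → ℝ) × ℝ}
    (hg : ContDiffAt ℝ n g z.2.1) : ContDiffAt ℝ n (activeSystem g J) z := by
  refine ContDiffAt.prodMk (contDiffAt_pi.2 fun i => ?_) (by fun_prop)
  have hgi : ContDiffAt ℝ n (fun z : ℝ × (ι → ℝ) × ℝ => g z.2.1 i) z :=
    contDiffAt_pi.1 (hg.comp z (by fun_prop)) i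
  split_ifs
  · exact hgi.sub (by fun_prop)
  · fun_prop

theorem fderiv_activeSystem {z : ℝ × (ι → ℝ) × ℝ} (hg : DifferentiableAt ℝ g z.2.1) :
    ⇑(fderiv ℝ (activeSystem g J) z) = activeSystem (fderiv ℝ g z.2.1) J := by
  have hx : HasFDerivAt (fun z : ℝ × (ι → ℝ) × ℝ => z.2.1)
      ((ContinuousLinearMap.fst ℝ (ι → ℝ) ℝ).comp (ContinuousLinearMap.snd ℝ ℝ _)) z :=
    hasFDerivAt_snd.fst
  have hμ : HasFDerivAt (fun z : ℝ × (ι → ℝ) × ℝ => z.2.2)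
      ((ContinuousLinearMap.snd ℝ (ι → ℝ) ℝ).comp (ContinuousLinearMap.snd ℝ ℝ _)) z :=
    hasFDerivAt_snd.snd
  have hgx := hasFDerivAt_pi'.1 (hg.hasFDerivAt.comp z hx)
  classical
  have hfst : HasFDerivAt (fun z => (activeSystem g J z).1) (ContinuousLinearMap.pi fun i =>
      if i ∈ J then _ else _) z := hasFDerivAt_pi.2 fun i => by
    by_cases hi : i ∈ J
    · simp only [activeSystem, if_pos hi]
      exact (hgx i).sub hμ
    · simp only [activeSystem, if_neg hi]
      exact hasFDerivAt_pi'.1 hx i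
  have hsnd : HasFDerivAt (fun z => (activeSystem g J z).2) _ z :=
    (HasFDerivAt.fun_sum fun i _ => hasFDerivAt_pi'.1 hx i).sub hasFDerivAt_fst
  rw [(hfst.prodMk hsnd).fderiv]
  ext y i
  · by_cases hi : i ∈ J <;> simp [activeSystem, hi]
  · simp [activeSystem]

/-- A continuously differentiable curve `x = c σ`, `μ = μ σ` of zeros `(σ, x, μ)` of the active
system, defined near `σ₀`. -/
structure IsActiveCurve (g : (ι → ℝ) → ι → ℝ) (J : Set ι) (σ₀ : ℝ) (c : ℝ → ι → ℝ) (μ : ℝ → ℝ) :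
    Prop where
  contDiffAt : ContDiffAt ℝ 1 c σ₀
  contDiffAt_multiplier : ContDiffAt ℝ 1 μ σ₀
  eventually_eq_zero : ∀ᶠ σ in 𝓝 σ₀, activeSystem g J (σ, c σ, μ σ) = 0

theorem exists_isActiveCurve {σ₀ μ₀ : ℝ} {x₀ : ι → ℝ} (hg : ContDiffAt ℝ 1 g x₀)
    (hinj : ∀ v w, activeSystem (fderiv ℝ g x₀) J (0, v, w) = 0 → v = 0 ∧ w = 0)
    (h₀ : activeSystem g J (σ₀, x₀, μ₀) = 0) :
    ∃ c μ, c σ₀ = x₀ ∧ μ σ₀ = μ₀ ∧ IsActiveCurve g J σ₀ c μ := by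
  have hF : ContDiffAt ℝ 1 (activeSystem g J) (σ₀, x₀, μ₀) := contDiffAt_activeSystem hg
  obtain ⟨ψ, hψ₀, hψ, hzero⟩ := exists_implicit_function one_ne_zero hF fun y hy =>
    Prod.ext_iff.2 (hinj y.1 y.2 (by
      rwa [fderiv_activeSystem (hg.differentiableAt one_ne_zero)] at hy))
  replace hψ₀ : ψ σ₀ = (x₀, μ₀) := hψ₀
  replace hψ : ContDiffAt ℝ 1 ψ σ₀ := hψ
  have hlim : Tendsto (fun σ => (σ, ψ σ)) (𝓝 σ₀) (𝓝 (σ₀, x₀, μ₀)) := by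
    rw [← hψ₀]
    exact continuousAt_id.prodMk hψ.continuousAt
  refine ⟨fun σ => (ψ σ).1, fun σ => (ψ σ).2, congrArg Prod.fst hψ₀, congrArg Prod.snd hψ₀,
    hψ.fst, hψ.snd, ?_⟩
  filter_upwards [hlim.eventually hzero] with σ hσ
  exact (hσ.2 rfl).trans h₀

theorem IsActiveCurve.activeSystem_deriv {σ₀ : ℝ} {c : ℝ → ι → ℝ} {μ : ℝ → ℝ}
    (h : IsActiveCurve g J σ₀ c μ) (hg : ContDiffAt ℝ 1 g (c σ₀)) :
    activeSystem (fderiv ℝ g (c σ₀)) J (1, deriv c σ₀, deriv μ σ₀) = 0 := by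
  have hcurve : HasDerivAt (fun σ => (σ, c σ, μ σ)) (1, deriv c σ₀, deriv μ σ₀) σ₀ :=
    (hasDerivAt_id σ₀).prodMk ((h.contDiffAt.differentiableAt one_ne_zero).hasDerivAt.prodMk
      (h.contDiffAt_multiplier.differentiableAt one_ne_zero).hasDerivAt)
  have hF : ContDiffAt ℝ 1 (activeSystem g J) (σ₀, c σ₀, μ σ₀) := contDiffAt_activeSystem hg
  have hcomp := (hF.differentiableAt one_ne_zero).hasFDerivAt.comp_hasDerivAt σ₀ hcurve
  rw [fderiv_activeSystem (hg.differentiableAt one_ne_zero)] at hcomp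
  exact hcomp.unique ((hasDerivAt_const σ₀ 0).congr_of_eventuallyEq h.eventually_eq_zero)

theorem IsActiveCurve.deriv_eq_zero {σ₀ : ℝ} {c : ℝ → ι → ℝ} {μ : ℝ → ℝ}
    (h : IsActiveCurve g J σ₀ c μ) {i : ι} (hi : i ∉ J) : deriv c σ₀ i = 0 := by
  have hci := hasDerivAt_pi.1 (h.contDiffAt.differentiableAt one_ne_zero).hasDerivAt i
  refine hci.unique ((hasDerivAt_const σ₀ (0 : ℝ)).congr_of_eventuallyEq ?_)
  filter_upwards [h.eventually_eq_zero] with σ hσ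
  exact (activeSystem_eq_zero_iff.1 hσ).2.1 i hi

theorem dotProduct_eq_of_activeSystem_eq_zero {s μ : ℝ} {x : ι → ℝ}
    (h : activeSystem g J (s, x, μ) = 0) : x ⬝ᵥ g x = s * μ := by
  obtain ⟨hJ, hJ', hs⟩ := activeSystem_eq_zero_iff.1 h
  rw [← hs, Finset.sum_mul]
  refine Finset.sum_congr rfl fun i _ => ?_
  by_cases hi : i ∈ J
  · rw [hJ i hi]
  · rw [hJ' i hi, zero_mul, zero_mul]

theorem eq_zero_of_activeSystem_mulVec {H : Matrix ι ι ℝ} (hH : H.PosDef) (hJ : J.Nonempty)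
    {v : ι → ℝ} {w : ℝ} (h : activeSystem (H *ᵥ ·) J (0, v, w) = 0) : v = 0 ∧ w = 0 := by
  have hv : v = 0 := by
    by_contra hv
    exact (hH.dotProduct_mulVec_pos hv).ne'
      ((dotProduct_eq_of_activeSystem_eq_zero h).trans (zero_mul w))
  obtain ⟨i, hi⟩ := hJ
  refine ⟨hv, ?_⟩
  rw [← (activeSystem_eq_zero_iff.1 h).1 i hi, hv, Matrix.mulVec_zero, Pi.zero_apply]

theorem pos_of_activeSystem_mulVec {H : Matrix ι ι ℝ} (hH : H.PosDef) {v : ι → ℝ} {w : ℝ}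
    (h : activeSystem (H *ᵥ ·) J (1, v, w) = 0) : 0 < w := by
  have hv : v ≠ 0 := fun hv => by
    have hsum := (activeSystem_eq_zero_iff.1 h).2.2
    simp [hv] at hsum
  have hq := dotProduct_eq_of_activeSystem_eq_zero h
  rw [one_mul] at hq
  exact hq ▸ hH.dotProduct_mulVec_pos hv

end ActiveSystem

section KKTCurve

variable {ι : Type*} [Fintype ι] [DecidableEq ι] {η : (ι → ℝ) → ℝ} {J : Set ι} {σ₀ : ℝ}

theorem exists_isActiveCurve_grad {μ₀ : ℝ} {x₀ : ι → ℝ} (hη : ContDiffAt ℝ 2 η x₀)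
    (hH : (hessian η x₀).PosDef) (hJ : J.Nonempty)
    (h₀ : activeSystem (grad η) J (σ₀, x₀, μ₀) = 0) :
    ∃ c μ, c σ₀ = x₀ ∧ μ σ₀ = μ₀ ∧ IsActiveCurve (grad η) J σ₀ c μ :=
  exists_isActiveCurve (contDiffAt_grad hη)
    (fun v w hvw => eq_zero_of_activeSystem_mulVec hH hJ (by
      simpa only [hessian_mulVec] using hvw)) h₀

theorem IsActiveCurve.deriv_pos {c : ℝ → ι → ℝ} {μ : ℝ → ℝ}
    (h : IsActiveCurve (grad η) J σ₀ c μ) (hη : ContDiffAt ℝ 2 η (c σ₀))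
    (hH : IsDiagDominant (hessian η (c σ₀))) {i : ι} (hi : i ∈ J) : 0 < deriv c σ₀ i := by
  have hlin : activeSystem (hessian η (c σ₀) *ᵥ ·) J (1, deriv c σ₀, deriv μ σ₀) = 0 := by
    simpa only [hessian_mulVec] using h.activeSystem_deriv (contDiffAt_grad hη)
  obtain ⟨hJ, hJ', -⟩ := activeSystem_eq_zero_iff.1 hlin
  exact hH.pos_of_mulVec_eq (pos_of_activeSystem_mulVec (hH.posDef (isSymm_hessian hη)) hlin)
    hJ hJ' hi

theorem eventually_pos_of_hasDerivAt {φ : ℝ → ℝ} {φ' s : ℝ} (h : HasDerivAt φ φ' s) (hφ' : 0 < φ')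
    (h₀ : 0 ≤ φ s) : ∀ᶠ t in 𝓝[>] s, 0 < φ t := by
  have hslope : Tendsto (slope φ s) (𝓝[>] s) (𝓝 φ') :=
    (hasDerivWithinAt_iff_tendsto_slope' self_notMem_Ioi).1 h.hasDerivWithinAt
  filter_upwards [hslope.eventually_const_lt hφ', self_mem_nhdsWithin] with t ht hst
  rw [slope_def_field, div_pos_iff_of_pos_right (sub_pos.2 hst)] at ht
  linarith

theorem IsActiveCurve.eventually_nonneg {c : ℝ → ι → ℝ} {μ : ℝ → ℝ}
    (h : IsActiveCurve (grad η) J σ₀ c μ) (hη : ContDiffAt ℝ 2 η (c σ₀))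
    (hH : IsDiagDominant (hessian η (c σ₀))) (h₀ : ∀ i, 0 ≤ c σ₀ i) :
    ∀ᶠ σ in 𝓝[≥] σ₀, ∀ i, 0 ≤ c σ i := by
  rw [← Ioi_insert, nhdsWithin_insert, eventually_sup, eventually_pure]
  refine ⟨h₀, eventually_all.2 fun i => ?_⟩
  by_cases hi : i ∈ J
  · have hci := hasDerivAt_pi.1 (h.contDiffAt.differentiableAt one_ne_zero).hasDerivAt i
    exact (eventually_pos_of_hasDerivAt hci (h.deriv_pos hη hH hi) (h₀ i)).mono fun σ hσ => hσ.le
  · filter_upwards [h.eventually_eq_zero.filter_mono nhdsWithin_le_nhds] with σ hσ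
    exact ((activeSystem_eq_zero_iff.1 hσ).2.1 i hi).ge

theorem IsActiveCurve.eventually_isLargestKKTMultiplier {c : ℝ → ι → ℝ} {μ : ℝ → ℝ}
    (h : IsActiveCurve (grad η) J σ₀ c μ) (hη : ContDiffAt ℝ 2 η (c σ₀)) (hJ : J.Nonempty)
    (hlt : ∀ i ∉ J, μ σ₀ < grad η (c σ₀) i) :
    ∀ᶠ σ in 𝓝 σ₀, IsLargestKKTMultiplier η (c σ) (μ σ) := by
  have hgrad : ContinuousAt (fun σ => grad η (c σ)) σ₀ :=
    (contDiffAt_grad hη).continuousAt.comp h.contDiffAt.continuousAt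
  have hlt' : ∀ᶠ σ in 𝓝 σ₀, ∀ i ∉ J, μ σ < grad η (c σ) i := by
    simp only [eventually_all]
    exact fun i hi => h.contDiffAt_multiplier.continuousAt.eventually_lt
      (continuousAt_pi.1 hgrad i) (hlt i hi)
  filter_upwards [h.eventually_eq_zero, hlt'] with σ hσ hσlt
  obtain ⟨heq, hzero, -⟩ := activeSystem_eq_zero_iff.1 hσ
  obtain ⟨k, hk⟩ := hJ
  refine ⟨⟨⟨k, heq k hk⟩, forall_mem_range.2 fun i => ?_⟩, fun i hi => heq i ?_⟩
  · by_cases hi : i ∈ J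
    exacts [(heq i hi).ge, (hσlt i hi).le]
  · exact not_imp_comm.1 (hzero i) hi.ne'

end KKTCurve

section Sensitivity

variable {N : ℕ} {η : (Fin N → ℝ) → ℝ} {σ₀ : ℝ}

theorem exists_kktCurve {x₀ : Fin N → ℝ} {μ₀ : ℝ} (hη : ContDiffAt ℝ 2 η x₀)
    (hH : IsDiagDominant (hessian η x₀)) (hx₀ : x₀ ∈ Sp N σ₀)
    (hμ₀ : IsLargestKKTMultiplier η x₀ μ₀) :
    ∃ c : ℝ → Fin N → ℝ, ContDiffAt ℝ 1 c σ₀ ∧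
      (∀ i, grad η x₀ i = μ₀ → 0 < deriv c σ₀ i) ∧
      (∀ i, grad η x₀ i ≠ μ₀ → deriv c σ₀ i = 0) ∧
      ∀ᶠ σ in 𝓝[≥] σ₀, c σ ∈ Sp N σ ∧ ∃ μ, IsLargestKKTMultiplier η (c σ) μ := by
  have hJ : {i | grad η x₀ i = μ₀}.Nonempty := hμ₀.1.1
  obtain ⟨c, μ, rfl, rfl, hc⟩ := exists_isActiveCurve_grad hη (hH.posDef (isSymm_hessian hη)) hJ
    (activeSystem_eq_zero_iff.2 ⟨fun i hi => hi, fun i hi =>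
      ((hx₀.1 i).eq_of_not_lt fun hpos => hi (hμ₀.2 i hpos)).symm, hx₀.2⟩)
  have hlt (i) (hi : grad η (c σ₀) i ≠ μ σ₀) : μ σ₀ < grad η (c σ₀) i :=
    (hμ₀.1.2 (mem_range_self i)).lt_of_ne' hi
  refine ⟨c, hc.contDiffAt, fun i hi => hc.deriv_pos hη hH hi, fun i hi => hc.deriv_eq_zero hi, ?_⟩
  filter_upwards [hc.eventually_nonneg hη hH hx₀.1,
    hc.eventually_eq_zero.filter_mono nhdsWithin_le_nhds,
    (hc.eventually_isLargestKKTMultiplier hη hJ hlt).filter_mono nhdsWithin_le_nhds]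
    with σ hnonneg hzero hkkt
  exact ⟨⟨hnonneg, (activeSystem_eq_zero_iff.1 hzero).2.2⟩, _, hkkt⟩

theorem eventually_hasDerivWithinAt_of_eventuallyEq {f c : ℝ → Fin N → ℝ}
    (hfc : f =ᶠ[𝓝[≥] σ₀] c) (hc : ContDiffAt ℝ 1 c σ₀) :
    ∀ᶠ σ in 𝓝[≥] σ₀, HasDerivWithinAt f (deriv c σ) (Ioi σ) σ := by
  have hdiff : ∀ᶠ σ in 𝓝[≥] σ₀, DifferentiableAt ℝ c σ :=
    ((hc.eventually (by simp)).filter_mono nhdsWithin_le_nhds).mono fun σ hσ =>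
      hσ.differentiableAt one_ne_zero
  obtain ⟨u, hu, hsub⟩ := mem_nhdsGE_iff_exists_Ico_subset.1 (hfc.and hdiff)
  filter_upwards [Ico_mem_nhdsGE hu] with σ hσ
  refine (hsub hσ).2.hasDerivAt.hasDerivWithinAt.congr_of_eventuallyEq ?_ (hsub hσ).1
  filter_upwards [Ioo_mem_nhdsGT hσ.2] with τ hτ
  exact (hsub ⟨hσ.1.trans hτ.1.le, hτ.2⟩).1

theorem rightDeriv_eventuallyEq {f c : ℝ → Fin N → ℝ} (hfc : f =ᶠ[𝓝[≥] σ₀] c)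
    (hc : ContDiffAt ℝ 1 c σ₀) : rightDeriv f =ᶠ[𝓝[≥] σ₀] deriv c :=
  (eventually_hasDerivWithinAt_of_eventuallyEq hfc hc).mono fun σ hσ =>
    hσ.derivWithin (uniqueDiffWithinAt_Ioi σ)

theorem hasDerivWithinAt_rightDeriv {f c : ℝ → Fin N → ℝ} (hfc : f =ᶠ[𝓝[≥] σ₀] c)
    (hc : ContDiffAt ℝ 1 c σ₀) : HasDerivWithinAt f (rightDeriv f σ₀) (Ioi σ₀) σ₀ := by
  have hmem : σ₀ ∈ Ici σ₀ := self_mem_Ici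
  rw [(rightDeriv_eventuallyEq hfc hc).eq_of_nhdsWithin hmem]
  exact (eventually_hasDerivWithinAt_of_eventuallyEq hfc hc).self_of_nhdsWithin hmem

theorem continuousWithinAt_rightDeriv {f c : ℝ → Fin N → ℝ} (hfc : f =ᶠ[𝓝[≥] σ₀] c)
    (hc : ContDiffAt ℝ 1 c σ₀) : ContinuousWithinAt (rightDeriv f) (Ioi σ₀) σ₀ := by
  have hderiv : ContinuousAt (deriv c) σ₀ :=
    (hc.fderiv_right (m := 0) (by norm_num)).continuousAt.clm_apply continuousAt_const
  have heq := rightDeriv_eventuallyEq hfc hc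
  exact hderiv.continuousWithinAt.congr_of_eventuallyEq
    (heq.filter_mono (nhdsWithin_mono _ Ioi_subset_Ici_self)) (heq.eq_of_nhdsWithin self_mem_Ici)

theorem rightDeriv_of_isMinOn {σmax μ₀ : ℝ} {f : ℝ → Fin N → ℝ}
    (hη : ∀ x ∈ Ch N σmax, ContDiffAt ℝ 2 η x)
    (hH : ∀ x ∈ Ch N σmax, IsDiagDominant (hessian η x))
    (hf : ∀ σ ∈ Icc 0 σmax, f σ ∈ Sp N σ ∧ IsMinOn η (Sp N σ) (f σ)) (hσ₀ : σ₀ ∈ Ico 0 σmax)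
    (hμ₀ : IsLargestKKTMultiplier η (f σ₀) μ₀) :
    HasDerivWithinAt f (rightDeriv f σ₀) (Ioi σ₀) σ₀ ∧
      ContinuousWithinAt (rightDeriv f) (Ioi σ₀) σ₀ ∧
      (∀ i, grad η (f σ₀) i = μ₀ → 0 < rightDeriv f σ₀ i) ∧
      (∀ i, grad η (f σ₀) i ≠ μ₀ → rightDeriv f σ₀ i = 0) := by
  have hfσ₀ := (hf σ₀ ⟨hσ₀.1, hσ₀.2.le⟩).1
  have hfCh := Sp_subset_Ch hσ₀.2.le hfσ₀
  obtain ⟨c, hc, hpos, hzero, hkkt⟩ := exists_kktCurve (hη _ hfCh) (hH _ hfCh) hfσ₀ hμ₀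
  have hfc : f =ᶠ[𝓝[≥] σ₀] c := by
    filter_upwards [hkkt, Ico_mem_nhdsGE hσ₀.2] with σ ⟨hcσ, μ, hμ⟩ hσ
    have hsub : Sp N σ ⊆ Ch N σmax := Sp_subset_Ch hσ.2.le
    obtain ⟨hfσ, hmin⟩ := hf σ ⟨hσ₀.1.trans hσ.1, hσ.2.le⟩
    by_contra hne
    exact (hmin hcσ).not_gt (hμ.lt_of_ne (fun z hz => hη z (hsub hz))
      (fun z hz => (hH z (hsub hz)).posDef (isSymm_hessian (hη z (hsub hz)))) hcσ hfσ hne)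
  have hderiv : rightDeriv f σ₀ = deriv c σ₀ :=
    (rightDeriv_eventuallyEq hfc hc).eq_of_nhdsWithin self_mem_Ici
  exact ⟨hasDerivWithinAt_rightDeriv hfc hc, continuousWithinAt_rightDeriv hfc hc,
    hderiv ▸ hpos, hderiv ▸ hzero⟩

end Sensitivity

/-! ### Hessians of parametrized and of separable functions -/

theorem eventually_contDiffAt_of_prod {ι E : Type*} [Fintype ι] [NormedAddCommGroup E]
    [NormedSpace ℝ E] {F : E → (ι → ℝ) → ℝ} {z : E × (ι → ℝ)}
    (h : ContDiffAt ℝ 2 (fun z => F z.1 z.2) z) : ∀ᶠ z in 𝓝 z, ContDiffAt ℝ 2 (F z.1) z.2 := by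
  filter_upwards [h.eventually (by simp)] with z hz
  exact ContDiffAt.comp (g := fun z => F z.1 z.2) (f := fun y => (z.1, y)) z.2 hz (by fun_prop)

theorem hasFDerivAt_comp_apply {ι : Type*} [Finite ι] {x : ι → ℝ} {s : ℝ → ℝ} {i : ι}
    (h : DifferentiableAt ℝ s (x i)) : HasFDerivAt (fun y : ι → ℝ => s (y i))
      (deriv s (x i) • (ContinuousLinearMap.proj i : (ι → ℝ) →L[ℝ] ℝ)) x := by
  have := Fintype.ofFinite ι
  exact HasDerivAt.comp_hasFDerivAt (f := fun y : ι → ℝ => y i) x h.hasDerivAt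
    (ContinuousLinearMap.proj (R := ℝ) (φ := fun _ : ι => ℝ) i).hasFDerivAt

section HessianLemmas

variable {ι : Type*} [Fintype ι] [DecidableEq ι] {x : ι → ℝ}

theorem contDiffAt_grad_of_prod {E : Type*} [NormedAddCommGroup E] [NormedSpace ℝ E]
    {F : E → (ι → ℝ) → ℝ} {z : E × (ι → ℝ)} (h : ContDiffAt ℝ 2 (fun z => F z.1 z.2) z) :
    ContDiffAt ℝ 1 (fun z => grad (F z.1) z.2) z := by
  have hF : ContDiffAt ℝ 2 (fun p : (E × (ι → ℝ)) × (ι → ℝ) => F p.1.1 p.2) (z, z.2) :=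
    ContDiffAt.comp (g := fun z : E × (ι → ℝ) => F z.1 z.2)
      (f := fun p : (E × (ι → ℝ)) × (ι → ℝ) => (p.1.1, p.2)) (z, z.2) h (by fun_prop)
  exact contDiffAt_pi.2 fun i =>
    (ContDiffAt.fderiv (f := fun z : E × (ι → ℝ) => F z.1) hF contDiffAt_snd
      (by norm_num)).clm_apply contDiffAt_const

theorem continuousAt_hessian_of_prod {E : Type*} [NormedAddCommGroup E] [NormedSpace ℝ E]
    {F : E → (ι → ℝ) → ℝ} {z : E × (ι → ℝ)} (h : ContDiffAt ℝ 2 (fun z => F z.1 z.2) z) :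
    ContinuousAt (fun z => hessian (F z.1) z.2) z := by
  have hgrad : ContDiffAt ℝ 1 (fun p : (E × (ι → ℝ)) × (ι → ℝ) => grad (F p.1.1) p.2) (z, z.2) :=
    ContDiffAt.comp (g := fun z : E × (ι → ℝ) => grad (F z.1) z.2)
      (f := fun p : (E × (ι → ℝ)) × (ι → ℝ) => (p.1.1, p.2)) (z, z.2)
      (contDiffAt_grad_of_prod h) (by fun_prop)
  refine continuousAt_pi.2 fun i => continuousAt_pi.2 fun j => ?_
  simp only [hessian_apply]
  exact continuousAt_pi.1
    ((ContDiffAt.fderiv (m := 0) (f := fun z : E × (ι → ℝ) => grad (F z.1)) hgrad contDiffAt_snd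
      (by norm_num)).continuousAt.clm_apply continuousAt_const) i

theorem hessian_congr_of_eventuallyEq {η η' : (ι → ℝ) → ℝ} (h : η =ᶠ[𝓝 x] η') :
    hessian η x = hessian η' x := by
  have hgrad : grad η =ᶠ[𝓝 x] grad η' := by
    filter_upwards [h.fderiv (𝕜 := ℝ)] with y hy
    ext i
    rw [grad, grad, hy]
  rw [hessian, hessian, hgrad.fderiv_eq]

theorem grad_sum_apply {t : ι → ℝ → ℝ} (h : ∀ i, DifferentiableAt ℝ (t i) (x i)) :
    grad (fun y => ∑ i, t i (y i)) x = fun i => deriv (t i) (x i) := by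
  ext i
  rw [grad, (HasFDerivAt.fun_sum fun i _ => hasFDerivAt_comp_apply (h i)).fderiv]
  simp [Pi.single_apply]

theorem hessian_sum_apply {t : ι → ℝ → ℝ} (h : ∀ i, ContDiffAt ℝ 2 (t i) (x i)) :
    hessian (fun y => ∑ i, t i (y i)) x = Matrix.diagonal fun i => deriv (deriv (t i)) (x i) := by
  have hgrad : grad (fun y => ∑ i, t i (y i)) =ᶠ[𝓝 x] fun y i => deriv (t i) (y i) := by
    have hdiff (i : ι) : ∀ᶠ y : ι → ℝ in 𝓝 x, DifferentiableAt ℝ (t i) (y i) :=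
      ((continuous_apply i).continuousAt.eventually ((h i).eventually (by simp))).mono
        fun y hy => hy.differentiableAt two_ne_zero
    filter_upwards [eventually_all.2 hdiff] with y hy using grad_sum_apply hy
  have hpi := hasFDerivAt_pi.2 fun i =>
    hasFDerivAt_comp_apply (differentiableAt_deriv_of_contDiffAt (h i))
  ext i j
  rw [hessian_apply, hgrad.fderiv_eq, hpi.fderiv, Matrix.diagonal_apply]
  simp [Pi.single_apply]

theorem isDiagDominant_diagonal {d : ι → ℝ} (hd : ∀ i, 0 < d i) :
    IsDiagDominant (Matrix.diagonal d) := fun i k => by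
  rw [Finset.sum_eq_zero fun j hj => ?_, mul_zero, Matrix.diagonal_apply_eq]
  · exact hd k
  · rw [Matrix.diagonal_apply_ne _ (Finset.ne_of_mem_erase hj).symm, abs_zero]

theorem isOpen_isDiagDominant : IsOpen {H : Matrix ι ι ℝ | IsDiagDominant H} := by
  simp only [IsDiagDominant, Set.ofPred_forall]
  refine isOpen_iInter_of_finite fun i => isOpen_iInter_of_finite fun k => ?_
  exact isOpen_lt (by fun_prop) (by fun_prop)

end HessianLemmas

/-! ### Block diagonal matrices and observability -/

theorem dotProduct_blockDiagonal_mulVec {m o : Type*} [Fintype m] [Fintype o] [DecidableEq o]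
    (M : o → Matrix m m ℝ) (x : m × o → ℝ) :
    x ⬝ᵥ (Matrix.blockDiagonal M *ᵥ x) =
      ∑ k, (fun i => x (i, k)) ⬝ᵥ (M k *ᵥ fun i => x (i, k)) := by
  rw [dotProduct, Fintype.sum_prod_type_right]
  simp only [dotProduct, Matrix.mulVec, Matrix.blockDiagonal_apply, Fintype.sum_prod_type,
    ite_mul, zero_mul, Finset.sum_ite_eq, Finset.mem_univ, if_true]

theorem posDef_blockDiagonal {m o : Type*} [Finite m] [Finite o] [DecidableEq o]
    {M : o → Matrix m m ℝ} (h : ∀ i, (M i).PosDef) : (Matrix.blockDiagonal M).PosDef := by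
  have := Fintype.ofFinite m
  have := Fintype.ofFinite o
  refine Matrix.PosDef.of_dotProduct_mulVec_pos
    (Matrix.isHermitian_blockDiagonal_iff.2 fun i => (h i).isHermitian) fun x hx => ?_
  obtain ⟨⟨i, k⟩, hik⟩ := Function.ne_iff.1 hx
  rw [star_trivial, dotProduct_blockDiagonal_mulVec]
  refine Finset.sum_pos' (fun l _ => ?_) ⟨k, Finset.mem_univ k, ?_⟩
  · exact (h l).posSemidef.dotProduct_mulVec_nonneg fun j => x (j, l)
  · exact (h k).dotProduct_mulVec_pos (x := fun j => x (j, k)) (Function.ne_iff.2 ⟨i, hik⟩)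

theorem ne_zero_of_observable {m q : Type*} [Fintype m] [DecidableEq m] [Nonempty m] [Fintype q]
    {A : Matrix m m ℝ} {c : Matrix m q ℝ} (h : Observable A c) : c ≠ 0 := by
  rintro rfl
  have hzero : controllabilityMatrix Aᵀ (0 : Matrix m q ℝ) = 0 := by
    ext i j
    simp [controllabilityMatrix]
  rw [Observable, Controllable, hzero, Matrix.rank_zero] at h
  exact Fintype.card_ne_zero h.symm

theorem posSemidef_mul_transpose_self {m q : Type*} [Finite m] [Fintype q] (c : Matrix m q ℝ) :
    (c * cᵀ).PosSemidef := by
  simpa using Matrix.posSemidef_self_mul_conjTranspose c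

theorem mul_transpose_self_ne_zero {m q : Type*} [Fintype q] {c : Matrix m q ℝ} (h : c ≠ 0) :
    c * cᵀ ≠ 0 := by
  simpa using (Matrix.self_mul_conjTranspose_eq_zero (A := c)).not.2 h

theorem posDef_mul_transpose_self {m : Type*} [Fintype m] [DecidableEq m] {G : Matrix m m ℝ}
    (h : IsUnit G) : (G * Gᵀ).PosDef := by
  simpa using Matrix.PosDef.mul_conjTranspose_self G (Matrix.vecMul_injective_of_isUnit h)

theorem sqrt_smul_mul_transpose {m q : Type*} [Fintype q] {r : ℝ} (hr : 0 ≤ r)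
    (c : Matrix m q ℝ) : (√r • c) * (√r • c)ᵀ = r • (c * cᵀ) := by
  rw [Matrix.transpose_smul, Matrix.smul_mul, Matrix.mul_smul, smul_smul, Real.mul_self_sqrt hr]

theorem exists_isGainFamily {m q : Type*} [Fintype m] [Fintype q] {A P X₀ : Matrix m m ℝ}
    {c : Matrix m q ℝ} (hP : P.PosDef) {r₀ : ℝ} (hr₀ : 0 < r₀)
    (hX₀ : IsPosDefAREsol A (√r₀ • c) P X₀) : ∃ X, IsGainFamily A (c * cᵀ) P X := by
  have h₀ := hX₀.2
  rw [sqrt_smul_mul_transpose hr₀.le] at h₀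
  choose! X hX using fun (r : ℝ) (hr : 0 < r) =>
    exists_riccati_smul_solution (posSemidef_mul_transpose_self c) hP hr₀ hX₀.1 h₀ hr
  exact ⟨X, hX⟩

/-! ### Networks near the decoupled one -/

namespace Network

variable {N n p : ℕ} (S : Network N n p) {rmin ε : ℝ} {γ : Fin N → ℝ}

/-- The information matrix `c_γ c_γᵀ`, continued to all `γ` as an affine function. -/
def infoMatrix (rmin : ℝ) (γ : Fin N → ℝ) : Matrix (Fin n × Fin N) (Fin n × Fin N) ℝ :=
  Matrix.blockDiagonal fun i => (γ i + rmin) • (S.c i * (S.c i)ᵀ)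

theorem cγ_mul_transpose (h : ∀ i, 0 ≤ γ i + rmin) :
    S.cγ rmin γ * (S.cγ rmin γ)ᵀ = S.infoMatrix rmin γ := by
  rw [infoMatrix, cγ, Matrix.blockDiagonal_transpose, ← Matrix.blockDiagonal_mul]
  exact congrArg _ (funext fun i => sqrt_smul_mul_transpose (h i) (S.c i))

theorem posSemidef_infoMatrix (h : ∀ i, 0 ≤ γ i + rmin) : (S.infoMatrix rmin γ).PosSemidef :=
  S.cγ_mul_transpose h ▸ posSemidef_mul_transpose_self _

theorem isSymm_infoMatrix (rmin : ℝ) (γ : Fin N → ℝ) : (S.infoMatrix rmin γ).IsSymm := by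
  rw [infoMatrix, Matrix.IsSymm, Matrix.blockDiagonal_transpose]
  exact congrArg _ (funext fun i =>
    ((isSymm_of_posSemidef (posSemidef_mul_transpose_self (S.c i))).smul _).eq)

theorem bigA_zero : S.bigA 0 = Matrix.blockDiagonal S.A := by
  ext ⟨a, i⟩ ⟨b, j⟩
  by_cases hij : i = j <;> simp [bigA, Matrix.blockDiagonal_apply, hij]

theorem bigA_eq_add_smul (ε : ℝ) : S.bigA ε = S.bigA 0 + ε • (S.bigA 1 - S.bigA 0) := by
  ext ⟨a, i⟩ ⟨b, j⟩
  by_cases hij : i = j <;> simp [bigA, hij]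

theorem isCov_iff (h : ∀ i, 0 ≤ γ i + rmin) {X : Matrix (Fin n × Fin N) (Fin n × Fin N) ℝ} :
    S.IsCov rmin ε γ X ↔
      X.PosDef ∧ riccati (S.bigA ε) (S.infoMatrix rmin γ) (S.bigG * S.bigGᵀ) X = 0 := by
  rw [IsCov, IsPosDefAREsol, S.cγ_mul_transpose h, riccati]

theorem isCov_blockDiagonal (h : ∀ i, 0 < γ i + rmin)
    {X : Fin N → ℝ → Matrix (Fin n) (Fin n) ℝ}
    (hX : ∀ i, IsGainFamily (S.A i) (S.c i * (S.c i)ᵀ) (S.G i * (S.G i)ᵀ) (X i)) :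
    S.IsCov rmin 0 γ (Matrix.blockDiagonal fun i => X i (γ i + rmin)) := by
  refine (S.isCov_iff fun i => (h i).le).2
    ⟨posDef_blockDiagonal fun i => (hX i _ (h i)).1, ?_⟩
  simp only [riccati, bigA_zero, infoMatrix, bigG, Matrix.blockDiagonal_transpose,
    ← Matrix.blockDiagonal_mul, ← Matrix.blockDiagonal_add, ← Matrix.blockDiagonal_sub]
  rw [← Matrix.blockDiagonal_zero]
  exact congrArg _ (funext fun i => (hX i _ (h i)).2)

/-- The network with coupling `ε` is well posed at the allocation `γ`: its error covariance exists,
and the estimation error is, to second order at `γ`, smooth with diagonally dominant Hessian. -/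
structure IsWellPosedAt (rmin ε : ℝ) (γ : Fin N → ℝ) : Prop where
  exists_isCov : ∃ X, S.IsCov rmin ε γ X
  contDiffAt : ContDiffAt ℝ 2 (S.η rmin ε) γ
  isDiagDominant : IsDiagDominant (hessian (S.η rmin ε) γ)

variable {S}

theorem posDef_bigG_mul_transpose (hG : ∀ i, IsUnit (S.G i)) : (S.bigG * S.bigGᵀ).PosDef := by
  rw [bigG, Matrix.blockDiagonal_transpose, ← Matrix.blockDiagonal_mul]
  exact posDef_blockDiagonal fun i => posDef_mul_transpose_self (hG i)

theorem isCov_unique (hG : ∀ i, IsUnit (S.G i)) (h : ∀ i, 0 ≤ γ i + rmin)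
    {X Y : Matrix (Fin n × Fin N) (Fin n × Fin N) ℝ} (hX : S.IsCov rmin ε γ X)
    (hY : S.IsCov rmin ε γ Y) : X = Y := by
  rw [S.isCov_iff h] at hX hY
  exact riccati_solution_unique (S.posSemidef_infoMatrix h) (posDef_bigG_mul_transpose hG)
    hX.1 hX.2 hY.1 hY.2

theorem η_eq_trace (hG : ∀ i, IsUnit (S.G i)) (h : ∀ i, 0 ≤ γ i + rmin)
    {X : Matrix (Fin n × Fin N) (Fin n × Fin N) ℝ} (hX : S.IsCov rmin ε γ X) :
    S.η rmin ε γ = X.trace := by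
  have hcov : S.IsCov rmin ε γ (S.cov rmin ε γ) := Classical.epsilon_spec ⟨X, hX⟩
  rw [η, isCov_unique hG h hcov hX]

theorem eventually_add_pos (h : ∀ i, 0 < γ i + rmin) : ∀ᶠ y in 𝓝 γ, ∀ i, 0 < y i + rmin :=
  eventually_all.2 fun i =>
    ((continuous_apply i).add continuous_const).continuousAt.eventually (lt_mem_nhds (h i))

open scoped Matrix.Norms.Operator in
theorem exists_contDiffAt_isCov (hG : ∀ i, IsUnit (S.G i)) (h : ∀ i, 0 < γ i + rmin)
    {X₀ : Matrix (Fin n × Fin N) (Fin n × Fin N) ℝ} (hX₀ : S.IsCov rmin ε γ X₀) :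
    ∃ X : ℝ × (Fin N → ℝ) → Matrix (Fin n × Fin N) (Fin n × Fin N) ℝ,
      ContDiffAt ℝ 2 X (ε, γ) ∧ ∀ᶠ z in 𝓝 (ε, γ), S.IsCov rmin z.1 z.2 (X z) := by
  have hA : ContDiffAt ℝ 2 (fun z : ℝ × (Fin N → ℝ) => S.bigA z.1) (ε, γ) := by
    simp_rw [fun z : ℝ × (Fin N → ℝ) => S.bigA_eq_add_smul z.1]
    exact contDiffAt_const.add (contDiffAt_fst.smul contDiffAt_const)
  have hC : ContDiffAt ℝ 2 (fun z : ℝ × (Fin N → ℝ) => S.infoMatrix rmin z.2) (ε, γ) := by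
    let L : (Fin N → Matrix (Fin n) (Fin n) ℝ) →ₗ[ℝ] Matrix (Fin n × Fin N) (Fin n × Fin N) ℝ :=
      ⟨⟨Matrix.blockDiagonal, Matrix.blockDiagonal_add⟩, Matrix.blockDiagonal_smul⟩
    have hcoeff (i : Fin N) : ContDiffAt ℝ 2 (fun z : ℝ × (Fin N → ℝ) => z.2 i + rmin) (ε, γ) := by
      fun_prop
    have hblocks : ContDiffAt ℝ 2 (fun (z : ℝ × (Fin N → ℝ)) i =>
        (z.2 i + rmin) • (S.c i * (S.c i)ᵀ)) (ε, γ) :=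
      contDiffAt_pi.2 fun i => (hcoeff i).smul contDiffAt_const
    exact (LinearMap.toContinuousLinearMap L).contDiff.contDiffAt.comp _ hblocks
  obtain ⟨hX₀pos, h₀⟩ := (S.isCov_iff fun i => (h i).le).1 hX₀
  have hP := posDef_bigG_mul_transpose hG
  obtain ⟨X, -, hX, hsol⟩ := exists_contDiffAt_riccati_solution two_ne_zero hA hC contDiffAt_const
    (fun z => S.isSymm_infoMatrix rmin z.2) (fun _ => isSymm_of_posDef hP)
    (S.posSemidef_infoMatrix fun i => (h i).le) hP hX₀pos h₀
  refine ⟨X, hX, ?_⟩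
  filter_upwards [hsol, continuous_snd.continuousAt.eventually (eventually_add_pos h)]
    with z hz hpos
  exact (S.isCov_iff fun i => (hpos i).le).2 hz

theorem contDiffAt_η (hG : ∀ i, IsUnit (S.G i)) (h : ∀ i, 0 < γ i + rmin)
    (hcov : ∃ X, S.IsCov rmin ε γ X) :
    ContDiffAt ℝ 2 (fun z : ℝ × (Fin N → ℝ) => S.η rmin z.1 z.2) (ε, γ) := by
  obtain ⟨X₀, hX₀⟩ := hcov
  obtain ⟨X, hX, hsol⟩ := exists_contDiffAt_isCov hG h hX₀
  refine (contDiffAt_trace hX).congr_of_eventuallyEq ?_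
  filter_upwards [hsol, continuous_snd.continuousAt.eventually (eventually_add_pos h)]
    with z hz hpos
  exact η_eq_trace hG (fun i => (hpos i).le) hz

theorem isDiagDominant_hessian_η_zero (hc : ∀ i, S.c i ≠ 0) (hG : ∀ i, IsUnit (S.G i))
    (h : ∀ i, 0 < γ i + rmin) {X : Fin N → ℝ → Matrix (Fin n) (Fin n) ℝ}
    (hX : ∀ i, IsGainFamily (S.A i) (S.c i * (S.c i)ᵀ) (S.G i * (S.G i)ᵀ) (X i)) :
    IsDiagDominant (hessian (S.η rmin 0) γ) := by
  have hη : S.η rmin 0 =ᶠ[𝓝 γ] fun y => ∑ i, (X i (y i + rmin)).trace := by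
    filter_upwards [eventually_add_pos h] with y hy
    rw [η_eq_trace hG (fun i => (hy i).le) (S.isCov_blockDiagonal hy hX),
      Matrix.trace_blockDiagonal]
  have hC i := posSemidef_mul_transpose_self (S.c i)
  have hP i := posDef_mul_transpose_self (hG i)
  have htrace (i : Fin N) : ContDiffAt ℝ 2 (fun s => (X i (s + rmin)).trace) (γ i) := by
    open scoped Matrix.Norms.Operator in
    exact contDiffAt_trace (((hX i).contDiffAt (hC i) (hP i) two_ne_zero (h i)).comp (γ i)
      (contDiffAt_id.add contDiffAt_const))
  rw [hessian_congr_of_eventuallyEq hη, hessian_sum_apply htrace]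
  refine isDiagDominant_diagonal fun i => ?_
  simp only [funext fun s => deriv_comp_add_const (fun r => (X i r).trace) rmin s,
    deriv_comp_add_const]
  exact (hX i).deriv_deriv_trace_pos (hC i) (mul_transpose_self_ne_zero (hc i)) (hP i) (h i)

theorem eventually_isWellPosedAt (hG : ∀ i, IsUnit (S.G i)) (h : ∀ i, 0 < γ i + rmin)
    (hγ : S.IsWellPosedAt rmin ε γ) : ∀ᶠ z in 𝓝 (ε, γ), S.IsWellPosedAt rmin z.1 z.2 := by
  obtain ⟨X₀, hX₀⟩ := hγ.exists_isCov
  obtain ⟨X, -, hsol⟩ := exists_contDiffAt_isCov hG h hX₀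
  have hη := contDiffAt_η hG h hγ.exists_isCov
  filter_upwards [hsol, eventually_contDiffAt_of_prod hη,
    (continuousAt_hessian_of_prod hη).eventually
      (isOpen_isDiagDominant.mem_nhds hγ.isDiagDominant)] with z hz hη hH
  exact ⟨⟨_, hz⟩, hη, hH⟩

theorem isWellPosedAt_zero (hc : ∀ i, S.c i ≠ 0) (hG : ∀ i, IsUnit (S.G i))
    (hsol : ∀ i, ∃ r : ℝ, 0 < r ∧ ∃ X, IsPosDefAREsol (S.A i) (√r • S.c i) (S.G i * (S.G i)ᵀ) X)
    (h : ∀ i, 0 < γ i + rmin) : S.IsWellPosedAt rmin 0 γ := by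
  choose r hr Y hY using hsol
  choose X hX using fun i => exists_isGainFamily (posDef_mul_transpose_self (hG i)) (hr i) (hY i)
  have hcov : ∃ X, S.IsCov rmin 0 γ X := ⟨_, S.isCov_blockDiagonal h hX⟩
  have hη : ContDiffAt ℝ 2 (S.η rmin 0) γ :=
    (eventually_contDiffAt_of_prod (contDiffAt_η hG h hcov)).self_of_nhds
  exact ⟨hcov, hη, isDiagDominant_hessian_η_zero hc hG h hX⟩

theorem exists_forall_isWellPosedAt {K : Set (Fin N → ℝ)} (hK : IsCompact K)
    (hpos : ∀ γ ∈ K, ∀ i, 0 < γ i + rmin) (hG : ∀ i, IsUnit (S.G i))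
    (h : ∀ γ ∈ K, S.IsWellPosedAt rmin 0 γ) :
    ∃ ε₀ : ℝ, 0 < ε₀ ∧ ∀ ε, |ε| ≤ ε₀ → ∀ γ ∈ K, S.IsWellPosedAt rmin ε γ := by
  have hev : ∀ᶠ ε in 𝓝 (0 : ℝ), ∀ γ ∈ K, S.IsWellPosedAt rmin ε γ :=
    hK.eventually_forall_of_forall_eventually fun γ hγ =>
      eventually_isWellPosedAt hG (hpos γ hγ) (h γ hγ)
  obtain ⟨ε₀, hε₀, hball⟩ := Metric.nhds_basis_closedBall.eventually_iff.1 hev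
  exact ⟨ε₀, hε₀, fun ε hε => hball (by simpa using hε)⟩

end Network

namespace Network

variable {N n p : ℕ} {S : Network N n p} {rmin ε σ μ : ℝ}

theorem f_mem_and_isMinOn (hN : 1 ≤ N) (hσ : 0 ≤ σ) (hη : ContinuousOn (S.η rmin ε) (Sp N σ)) :
    S.f rmin ε σ ∈ Sp N σ ∧ IsMinOn (S.η rmin ε) (Sp N σ) (S.f rmin ε σ) :=
  Classical.epsilon_spec ((isCompact_Sp N σ).exists_isMinOn (nonempty_Sp hN hσ) hη)

theorem dη_eq_grad {γ : Fin N → ℝ} (hη : DifferentiableAt ℝ (S.η rmin ε) γ) :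
    S.dη rmin ε γ = grad (S.η rmin ε) γ :=
  funext fun _ => hη.lineDeriv_eq_fderiv

theorem isGreatest_isKKTMultiplier (hη : DifferentiableAt ℝ (S.η rmin ε) (S.f rmin ε σ))
    (hμ : IsLargestKKTMultiplier (S.η rmin ε) (S.f rmin ε σ) μ) :
    IsGreatest {μ | S.IsKKTMultiplier rmin ε σ μ} μ := by
  obtain ⟨⟨⟨k, hk⟩, hle⟩, hactive⟩ := hμ
  simp only [IsKKTMultiplier, dη_eq_grad hη]
  refine ⟨⟨hactive, fun j _ => hle (mem_range_self j)⟩, fun ν hν => ?_⟩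
  by_cases hkI : k ∈ S.I rmin ε σ
  · exact ((hν.1 k hkI).symm.trans hk).le
  · exact (hν.2 k hkI).trans_eq hk

theorem isLargestKKTMultiplier_kktMultiplier (hN : 1 ≤ N)
    (hη : DifferentiableAt ℝ (S.η rmin ε) (S.f rmin ε σ))
    (hf : S.f rmin ε σ ∈ Sp N σ ∧ IsMinOn (S.η rmin ε) (Sp N σ) (S.f rmin ε σ)) :
    IsLargestKKTMultiplier (S.η rmin ε) (S.f rmin ε σ) (S.kktMultiplier rmin ε σ) := by
  obtain ⟨μ, hμ⟩ := exists_isLargestKKTMultiplier_of_isMinOn hN hf.1 hf.2 hη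
  rwa [kktMultiplier, (isGreatest_isKKTMultiplier hη hμ).csSup_eq]

theorem mem_J_iff {i : Fin N} (hη : DifferentiableAt ℝ (S.η rmin ε) (S.f rmin ε σ)) :
    i ∈ S.J rmin ε σ ↔ grad (S.η rmin ε) (S.f rmin ε σ) i = S.kktMultiplier rmin ε σ := by
  rw [J, Set.mem_ofPred_eq, dη_eq_grad hη]

end Network

end

end OptAlloc

theorem mainTheorem8_general {N n p : ℕ} (hN : 1 ≤ N) (S : OptAlloc.Network N n p)
    (hc : ∀ i, S.c i ≠ 0) (hG : ∀ i, IsUnit (S.G i))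
    (hsol : ∀ i, ∃ r : ℝ, 0 < r ∧ ∃ X : Matrix (Fin n) (Fin n) ℝ,
      OptAlloc.IsPosDefAREsol (S.A i) (Real.sqrt r • S.c i) (S.G i * (S.G i).transpose) X)
    (rmin : ℝ) (hrmin : 0 < rmin) (σmax : ℝ) :
    ∃ ε₀ : ℝ, 0 < ε₀ ∧ ∀ ε : ℝ, |ε| ≤ ε₀ →
      (∀ γ ∈ OptAlloc.Ch N σmax,
        (∃! X, S.IsCov rmin ε γ X) ∧ DifferentiableAt ℝ (S.η rmin ε) γ) ∧
      (∀ σ ∈ Set.Icc 0 σmax,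
        S.f rmin ε σ ∈ OptAlloc.Sp N σ ∧
        (∀ γ ∈ OptAlloc.Sp N σ, γ ≠ S.f rmin ε σ →
          S.η rmin ε (S.f rmin ε σ) < S.η rmin ε γ) ∧
        IsGreatest {μ | S.IsKKTMultiplier rmin ε σ μ} (S.kktMultiplier rmin ε σ)) ∧
      (∀ σ ∈ Set.Ico 0 σmax,
        HasDerivWithinAt (S.f rmin ε) (OptAlloc.rightDeriv (S.f rmin ε) σ) (Set.Ioi σ) σ ∧
        ContinuousWithinAt (OptAlloc.rightDeriv (S.f rmin ε)) (Set.Ioi σ) σ ∧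
        (∀ i ∈ S.J rmin ε σ, 0 < OptAlloc.rightDeriv (S.f rmin ε) σ i) ∧
        (∀ i ∉ S.J rmin ε σ, OptAlloc.rightDeriv (S.f rmin ε) σ i = 0)) := by
  open OptAlloc OptAlloc.Network in
  have hpos γ (hγ : γ ∈ Ch N σmax) : ∀ i, 0 < γ i + rmin := add_pos_of_mem_Ch hrmin hγ
  obtain ⟨ε₀, hε₀, hwell⟩ := exists_forall_isWellPosedAt (isCompact_Ch N σmax) hpos hG
    fun γ hγ => isWellPosedAt_zero hc hG hsol (hpos γ hγ)
  refine ⟨ε₀, hε₀, fun ε hε => ?_⟩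
  replace hwell := hwell ε hε
  have hη γ (hγ : γ ∈ Ch N σmax) := (hwell γ hγ).contDiffAt
  have hdiff γ (hγ : γ ∈ Ch N σmax) := (hη γ hγ).differentiableAt two_ne_zero
  have hH γ (hγ : γ ∈ Ch N σmax) := (hwell γ hγ).isDiagDominant
  have hf σ (hσ : σ ∈ Set.Icc 0 σmax) := f_mem_and_isMinOn hN hσ.1 fun γ hγ =>
    (hdiff γ (Sp_subset_Ch hσ.2 hγ)).continuousAt.continuousWithinAt
  have hdf σ (hσ : σ ∈ Set.Icc 0 σmax) := hdiff _ (Sp_subset_Ch hσ.2 (hf σ hσ).1)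
  have hμ σ (hσ : σ ∈ Set.Icc 0 σmax) :=
    isLargestKKTMultiplier_kktMultiplier hN (hdf σ hσ) (hf σ hσ)
  refine ⟨fun γ hγ => ⟨?_, hdiff γ hγ⟩, fun σ hσ => ⟨(hf σ hσ).1, fun γ hγ hne => ?_,
    isGreatest_isKKTMultiplier (hdf σ hσ) (hμ σ hσ)⟩, fun σ hσ => ?_⟩
  · obtain ⟨X, hX⟩ := (hwell γ hγ).exists_isCov
    exact ⟨X, hX, fun Y hY => isCov_unique hG (fun i => (hpos γ hγ i).le) hY hX⟩
  · exact (hμ σ hσ).lt_of_ne (fun x hx => hη x (Sp_subset_Ch hσ.2 hx))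
      (fun x hx => (hH x (Sp_subset_Ch hσ.2 hx)).posDef
        (isSymm_hessian (hη x (Sp_subset_Ch hσ.2 hx)))) (hf σ hσ).1 hγ hne
  · have hσ' : σ ∈ Set.Icc 0 σmax := ⟨hσ.1, hσ.2.le⟩
    simp only [mem_J_iff (hdf σ hσ')]
    exact rightDeriv_of_isMinOn hη hH hf hσ (hμ σ hσ')

theorem mainTheorem8 {N n p : ℕ} (hN : 1 ≤ N) (hn : 1 ≤ n) (S : OptAlloc.Network N n p)
    (hS : S.SubsystemAssumption) (rmin : ℝ) (hrmin : 0 < rmin) (σmax : ℝ) (hσmax : 0 < σmax) :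
    ∃ ε₀ : ℝ, 0 < ε₀ ∧ ∀ ε : ℝ, |ε| ≤ ε₀ →
      -- the error `η` is well defined and differentiable on `Ch[σ_max]`
      (∀ γ ∈ OptAlloc.Ch N σmax,
        (∃! X, S.IsCov rmin ε γ X) ∧ DifferentiableAt ℝ (S.η rmin ε) γ) ∧
      -- `f(σ)` is the unique minimizer of `η` on `Sp[σ]`, and `μ_σ` is the KKT multiplier
      (∀ σ ∈ Set.Icc 0 σmax,
        S.f rmin ε σ ∈ OptAlloc.Sp N σ ∧
        (∀ γ ∈ OptAlloc.Sp N σ, γ ≠ S.f rmin ε σ →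
          S.η rmin ε (S.f rmin ε σ) < S.η rmin ε γ) ∧
        IsGreatest {μ | S.IsKKTMultiplier rmin ε σ μ} (S.kktMultiplier rmin ε σ)) ∧
      -- the right-derivative exists, is right-continuous, and has the stated signs
      (∀ σ ∈ Set.Ico 0 σmax,
        HasDerivWithinAt (S.f rmin ε) (OptAlloc.rightDeriv (S.f rmin ε) σ) (Set.Ioi σ) σ ∧
        ContinuousWithinAt (OptAlloc.rightDeriv (S.f rmin ε)) (Set.Ioi σ) σ ∧
        (∀ i ∈ S.J rmin ε σ, 0 < OptAlloc.rightDeriv (S.f rmin ε) σ i) ∧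
        (∀ i ∉ S.J rmin ε σ, OptAlloc.rightDeriv (S.f rmin ε) σ i = 0)) := by
  have : Nonempty (Fin n) := ⟨⟨0, hn⟩⟩
  exact mainTheorem8_general hN S (fun i => OptAlloc.ne_zero_of_observable (hS i).1)
    (fun i => (hS i).2.1) (fun i => (hS i).2.2.2.2.imp fun _ => And.imp_right <|
      Exists.imp fun _ => And.left) rmin hrmin σmax
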